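/- Let $l\ge 1$ and $r$ be integers with $n=rl$. Let $\mathfrak g=Q(n)$ be the queer Lie superalgebra over $\mathbb C$, i.e. the space of block matrices $\begin{pmatrix}A&B\\B&A\end{pmatrix}$ with $A,B$ complex $n\times n$ matrices ($B=0$: even, $A=0$: odd), with the supercommutator as bracket, and let $\mathrm{otr}\begin{pmatrix}A&B\\B&A\end{pmatrix}=\mathrm{tr}\,B$. Let $e_{i,j}$ (with $A=E_{ij}$, $B=0$) and $f_{i,j}$ (with $A=0$, $B=E_{ij}$) be its standard basis, and $U(\mathfrak g)$ its universal enveloping superalgebra. Put $E=\sum_{p=1}^{r}\sum_{i=1}^{l-1}f_{l(p-1)+i,\,l(p-1)+i+1}$ and $\chi(x)=\mathrm{otr}(xE)$ for $x\in\mathfrak g$; this $\chi$ is an even nilpotent functional whose Jordan blocks all have size $l$. Let $\mathfrak m$ be the span of all $e_{l(p-1)+i+k,\,l(q-1)+i}$ and $f_{l(p-1)+i+k,\,l(q-1)+i}$ with $1\le k\le l-1$, $1\le i\le l-k$, $1\le p,q\le r$ (the negative part of the Dynkin grading). Let $I_\chi$ be the left ideal of $U(\mathfrak g)$ generated by all $a-\chi(a)$,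 $a\in\mathfrak m$, let $Q_\chi=U(\mathfrak g)/I_\chi$ be the generalized Whittaker module, and $\pi:U(\mathfrak g)\to Q_\chi$ the projection. The finite $W$-algebra is $W_\chi=\mathrm{End}_{U(\mathfrak g)}(Q_\chi)^{op}$, identified through $w\mapsto w(\pi(1))$ with $$Q_\chi^{\mathfrak m}=\{u\in Q_\chi : au=\chi(a)u\ \text{ for all } a\in\mathfrak m\},$$ so that $\pi(y_1)\pi(y_2)=\pi(y_1y_2)$ for $\pi(y_1),\pi(y_2)\in Q_\chi^{\mathfrak m}$. Define Sergeev's elements of $U(\mathfrak g)$ by $e^{(0)}_{i,j}=\delta_{i,j}$, $f^{(0)}_{i,j}=0$ and, for $m\ge1$, $$e^{(m)}_{i,j}=\sum_{k=1}^n e_{i,k}e^{(m-1)}_{k,j}+(-1)^{m+1}\sum_{k=1}^n f_{i,k}f^{(m-1)}_{k,j},\qquad f^{(m)}_{i,j}=\sum_{k=1}^n e_{i,k}f^{(m-1)}_{k,j}+(-1)^{m+1}\sum_{k=1}^n f_{i,k}e^{(m-1)}_{k,j}.$$ Theorem. The elements $\pi\big(e^{(l+k-1)}_{lp,\,l(q-1)+1}\big)$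 and $\pi\big(f^{(l+k-1)}_{lp,\,l(q-1)+1}\big)$, for $p,q=1,\dots,r$ and $k=1,\dots,l$, belong to $W_\chi$ and generate it as a unital associative algebra over $\mathbb C$. -/

import Mathlib

namespace QueerW

noncomputable section

/-! ### The queer Lie superalgebra `Q(n)` -/

/-- The complex `2n × 2n` matrices, written in `n × n` blocks. -/
abbrev BlockMat (n : ℕ) : Type := Matrix (Fin n ⊕ Fin n) (Fin n ⊕ Fin n) ℂ

/-- `Q(n)`: the block matrices of the form `[[A, B], [B, A]]`. They are closed under the
associative product, and the Lie superbracket is the supercommutator. -/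
def Q (n : ℕ) : Subalgebra ℂ (BlockMat n) where
  carrier := {X | ∃ A B : Matrix (Fin n) (Fin n) ℂ, X = Matrix.fromBlocks A B B A}
  mul_mem' := by
    rintro _ _ ⟨A, B, rfl⟩ ⟨C, D, rfl⟩
    refine ⟨A * C + B * D, A * D + B * C, ?_⟩
    rw [Matrix.fromBlocks_multiply, add_comm (B * C), add_comm (B * D) (A * C)]
  add_mem' := by
    rintro _ _ ⟨A, B, rfl⟩ ⟨C, D, rfl⟩
    exact ⟨A + C, B + D, Matrix.fromBlocks_add _ _ _ _ _ _ _ _⟩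
  algebraMap_mem' := by
    intro c
    refine ⟨algebraMap ℂ _ c, 0, ?_⟩
    rw [Algebra.algebraMap_eq_smul_one, Algebra.algebraMap_eq_smul_one,
      ← Matrix.fromBlocks_one, Matrix.fromBlocks_smul, smul_zero]

/-- `x` is homogeneous of parity `a`: even (`a = 0`) means `B = 0`, odd (`a = 1`) means `A = 0`. -/
def IsHomogeneous {n : ℕ} (a : Fin 2) (x : Q n) : Prop :=
  if a = 0 then Matrix.toBlocks₁₂ (x : BlockMat n) = 0
  else Matrix.toBlocks₁₁ (x : BlockMat n) = 0

/-- The superbracket `[x, y] = x y - (-1)^{ab} y x` of `x` of parity `a` and `y` of parity `b`. -/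
def superbracket {n : ℕ} (a b : Fin 2) (x y : Q n) : Q n :=
  x * y - (-1 : ℂ) ^ (a.val * b.val) • (y * x)

/-- The odd trace `otr [[A, B], [B, A]] = tr B`. -/
def otr {n : ℕ} (x : Q n) : ℂ := Matrix.trace (Matrix.toBlocks₁₂ (x : BlockMat n))

/-- The even basis element `e_{i,j}`. -/
def e {n : ℕ} (i j : Fin n) : Q n :=
  ⟨Matrix.fromBlocks (Matrix.single i j 1) 0 0 (Matrix.single i j 1), _, _, rfl⟩

/-- The odd basis element `f_{i,j}`. -/
def f {n : ℕ} (i j : Fin n) : Q n :=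
  ⟨Matrix.fromBlocks 0 (Matrix.single i j 1) (Matrix.single i j 1) 0, _, _, rfl⟩

/-! ### The universal enveloping superalgebra `U(Q(n))` -/

/-- The defining relations `x ⊗ y - (-1)^{ab} y ⊗ x = [x, y]` for homogeneous `x, y`. -/
inductive EnvRel (n : ℕ) : TensorAlgebra ℂ (Q n) → TensorAlgebra ℂ (Q n) → Prop
  | bracket (a b : Fin 2) (x y : Q n) (hx : IsHomogeneous a x) (hy : IsHomogeneous b y) :
      EnvRel n
        (TensorAlgebra.ι ℂ x * TensorAlgebra.ι ℂ y -
          (-1 : ℂ) ^ (a.val * b.val) • (TensorAlgebra.ι ℂ y * TensorAlgebra.ι ℂ x))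
        (TensorAlgebra.ι ℂ (superbracket a b x y))

/-- `U(Q(n))`. -/
def U (n : ℕ) : Type := RingQuot (EnvRel n)

instance (n : ℕ) : Ring (U n) := inferInstanceAs (Ring (RingQuot (EnvRel n)))

instance (n : ℕ) : Algebra ℂ (U n) := inferInstanceAs (Algebra ℂ (RingQuot (EnvRel n)))

/-- The quotient map from the tensor algebra. -/
def tensorToU (n : ℕ) : TensorAlgebra ℂ (Q n) →ₐ[ℂ] U n := RingQuot.mkAlgHom ℂ (EnvRel n)

/-- The canonical map `Q(n) → U(Q(n))`. -/
def ι (n : ℕ) : Q n →ₗ[ℂ] U n :=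
  (tensorToU n).toLinearMap ∘ₗ TensorAlgebra.ι ℂ

/-- The commutation relations of `U(Q(n))`. -/
theorem ι_superbracket {n : ℕ} (a b : Fin 2) (x y : Q n) (hx : IsHomogeneous a x)
    (hy : IsHomogeneous b y) :
    ι n x * ι n y - (-1 : ℂ) ^ (a.val * b.val) • (ι n y * ι n x) =
      ι n (superbracket a b x y) := by
  have h : tensorToU n _ = tensorToU n _ :=
    RingQuot.mkAlgHom_rel ℂ (EnvRel.bracket a b x y hx hy)
  rw [map_sub, map_smul, map_mul, map_mul] at h
  exact h

/-- The pair `(e_{i,j}^{(m)}, f_{i,j}^{(m)})` of Sergeev's elements of `U(Q(n))`. -/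
def sergeev {n : ℕ} : ℕ → Fin n → Fin n → U n × U n
  | 0, i, j => (if i = j then 1 else 0, 0)
  | m + 1, i, j =>
      (∑ k, ι n (e i k) * (sergeev m k j).1 +
          (-1) ^ (m + 1 + 1) * ∑ k, ι n (f i k) * (sergeev m k j).2,
        ∑ k, ι n (e i k) * (sergeev m k j).2 +
          (-1) ^ (m + 1 + 1) * ∑ k, ι n (f i k) * (sergeev m k j).1)

/-- `e_{i,j}^{(m)}`. -/
def eS {n : ℕ} (m : ℕ) (i j : Fin n) : U n := (sergeev m i j).1

/-- `f_{i,j}^{(m)}`. -/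
def fS {n : ℕ} (m : ℕ) (i j : Fin n) : U n := (sergeev m i j).2

/-! ### The character `χ` with `r` Jordan blocks of size `l`, `n = r l` -/

variable (r l : ℕ)

/-- The `i`-th index of the `p`-th block. With indices counted from `1` it is `l (p - 1) + i`;
here everything is counted from `0`, so that its value is `l p + i`. -/
def idx {r l : ℕ} (p : Fin r) (i : Fin l) : Fin (r * l) := finProdFinEquiv (p, i)

/-- `E = ∑_p ∑_{i=1}^{l-1} f_{l(p-1)+i, l(p-1)+i+1}`. -/
def E : Q (r * l) :=
  ∑ p : Fin r, ∑ i : Fin (l - 1),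
    f (idx p (⟨i.val, by omega⟩ : Fin l)) (idx p (⟨i.val + 1, by omega⟩ : Fin l))

/-- `χ(x) = (x | E) = otr (x E)`. -/
def χ (x : Q (r * l)) : ℂ := otr (x * E r l)

/-- The graded piece `𝔤_d` of the Dynkin grading, i.e. of the grading by eigenvalues of `ad h`,
`h = ∑_p ∑_i (l - 2 i + 1) e_{l(p-1)+i, l(p-1)+i}`: it is spanned by the
`e_{l(p-1)+i, l(q-1)+j}` and `f_{l(p-1)+i, l(q-1)+j}` with `2 (j - i) = d`. -/
def gradedPiece (d : ℤ) : Submodule ℂ (Q (r * l)) :=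
  Submodule.span ℂ {x | ∃ (p q : Fin r) (i j : Fin l), 2 * ((j.val : ℤ) - (i.val : ℤ)) = d ∧
    (x = e (idx p i) (idx q j) ∨ x = f (idx p i) (idx q j))}

/-- `𝔪 = ⨁_{k=1}^{l-1} 𝔤_{-2k}`. -/
def 𝔪 : Submodule ℂ (Q (r * l)) :=
  ⨆ k ∈ Finset.Icc 1 (l - 1), gradedPiece r l (-(2 * (k : ℤ)))

/-- The left ideal `I_χ` of `U(Q(n))` generated by all `a - χ(a)`, `a ∈ 𝔪`. -/
def I : Submodule (U (r * l)) (U (r * l)) :=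
  Submodule.span (U (r * l))
    {y | ∃ a ∈ 𝔪 r l, y = ι (r * l) a - algebraMap ℂ (U (r * l)) (χ r l a)}

/-- The generalized Whittaker module `Q_χ = U(Q(n)) / I_χ`. -/
abbrev Whit : Type := U (r * l) ⧸ I r l

/-- The projection `π : U(Q(n)) → U(Q(n)) / I_χ`. -/
def π : U (r * l) →ₗ[U (r * l)] Whit r l := (I r l).mkQ

/-! ### The finite `W`-algebra -/

/-- `W_χ = End_{U(Q(n))}(Q_χ)^{op}`. -/
abbrev W : Type := (Module.End (U (r * l)) (Whit r l))ᵐᵒᵖ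

/-- `Q_χ^𝔪 = {u ∈ Q_χ | a u = χ(a) u for all a ∈ 𝔪}`. -/
def whittakerVectors : Submodule ℂ (Whit r l) where
  carrier := {u | ∀ a ∈ 𝔪 r l, ι (r * l) a • u = χ r l a • u}
  add_mem' := by
    intro u v hu hv a ha
    rw [smul_add, smul_add, hu a ha, hv a ha]
  zero_mem' := by
    intro a _
    rw [smul_zero, smul_zero]
  smul_mem' := by
    intro c u hu a ha
    rw [smul_comm (ι (r * l) a) c u, hu a ha, smul_comm]

variable {r l}

theorem ι_smul_π_one {a : Q (r * l)} (ha : a ∈ 𝔪 r l) :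
    ι (r * l) a • π r l 1 = χ r l a • π r l 1 := by
  have h : ι (r * l) a - algebraMap ℂ (U (r * l)) (χ r l a) ∈ I r l :=
    Submodule.subset_span ⟨a, ha, rfl⟩
  have h2 : π r l (ι (r * l) a - algebraMap ℂ (U (r * l)) (χ r l a)) = 0 :=
    (Submodule.Quotient.mk_eq_zero _).2 h
  rw [map_sub, sub_eq_zero] at h2
  rw [← map_smul, smul_eq_mul, mul_one, h2, ← algebraMap_smul (U (r * l)) (χ r l a) (π r l 1),
    ← map_smul, smul_eq_mul, mul_one]

theorem I_le_ker {u : Whit r l} (hu : u ∈ whittakerVectors r l) :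
    I r l ≤ LinearMap.ker (LinearMap.toSpanSingleton (U (r * l)) (Whit r l) u) := by
  refine Submodule.span_le.2 ?_
  rintro _ ⟨a, ha, rfl⟩
  rw [SetLike.mem_coe, LinearMap.mem_ker, LinearMap.toSpanSingleton_apply, sub_smul, hu a ha,
    algebraMap_smul, sub_self]

variable (r l)

/-- The identification `W_χ ≅ Q_χ^𝔪`, `w ↦ w (π 1)` (Frobenius reciprocity). -/
def frobenius : W r l ≃ₗ[ℂ] whittakerVectors r l where
  toFun w := ⟨w.unop (π r l 1), fun a ha => by
    rw [← map_smul, ι_smul_π_one ha, ← algebraMap_smul (U (r * l)) (χ r l a) (π r l 1), map_smul,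
      algebraMap_smul]⟩
  map_add' _ _ := rfl
  map_smul' _ _ := rfl
  invFun u := MulOpposite.op ((I r l).liftQ _ (I_le_ker u.2))
  left_inv w := by
    apply MulOpposite.unop_injective
    apply Submodule.linearMap_qext
    apply LinearMap.ext_ring
    simp [π]
  right_inv u := by
    apply Subtype.ext
    simp [π]

variable {r l}

/-- Under this identification the product of `W_χ` is `π(y₁) π(y₂) = π(y₁ y₂)`. -/
theorem frobenius_mul (w₁ w₂ : W r l) (y₁ y₂ : U (r * l))
    (h₁ : (frobenius r l w₁ : Whit r l) = π r l y₁)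
    (h₂ : (frobenius r l w₂ : Whit r l) = π r l y₂) :
    (frobenius r l (w₁ * w₂) : Whit r l) = π r l (y₁ * y₂) := by
  change w₁.unop (π r l 1) = _ at h₁
  change w₂.unop (π r l 1) = _ at h₂
  change w₂.unop (w₁.unop (π r l 1)) = _
  have h₃ : π r l y₁ = y₁ • π r l 1 := by rw [← map_smul, smul_eq_mul, mul_one]
  rw [h₁, h₃, map_smul, h₂, ← map_smul, smul_eq_mul]

end

end QueerW

/-!
The elements `π(e^{(m)}_{lp, l(q-1)+1})` and `π(f^{(m)}_{lp, l(q-1)+1})` are Whittaker vectors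
because Sergeev's elements transform under the adjoint action like matrix units (`gen_mul_ser`):
no element of `𝔪` starts at the first position of a block or ends at the last one, so those
elements supercommute with `𝔪`.

That they generate is shown on the associated graded module of the Kazhdan filtration `filt` of
`Q_χ = U / I_χ`. Write `e_{a,b}` or `f_{a,b}` for a basis element, and `pos a` for the position of
`a` in its block; the basis element has degree `pos b - pos a + 1` (half the usual Kazhdan
degree), which is at least `1` exactly when it is in the nonnegative part of the Dynkin grading.
`filt d` is spanned by the words of degree at most `d` in such basis elements, applied to `π(1)`.
Commutators lower the degree by `1`, and on the graded module `𝔪` acts through `χ`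
(`gen_smul_sub_mem`).

The symbol of a generator of degree `k` is, up to products of elements of smaller degree, the sum
of the basis elements of degree `k` between two given blocks, with signs
(`exists_ser_smul_sub_mem`). Hence the generators, together with the basis elements
`t = (ε, a, c)` with `pos a ≤ pos c` and `c` not a last position (`trim`), span the filtration through words
(`filt_le_wordSpan_trim`).

The remaining `t` are eliminated by Euler operators. For such a `t` let `y` be the basis element
of `𝔪` of the same parity from the successor of `c` to `a`. Then `χ([y, t']) = δ_{t,t'}` for all
`t'` which do not exceed `t` in the lexicographic order by degree and starting position
(`bracket_smul_sub_mem`), while `[y, z] = 0` for the generators `z`. So, on words in the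
generators and in such `t'`, the operator `t (y - χ(y))` counts modulo lower degree the
occurrences of `t` (`euler_wordVec_sub_mem`). It annihilates Whittaker vectors, so `t` can be
removed from the leading term of a Whittaker vector; in decreasing order all `t` are removed
(`mem_sup_of_mem_whittakerVectors`). Induction on the degree shows that a Whittaker vector is a
polynomial in the generators applied to `π(1)`. Only spanning statements are needed, so the
Poincaré–Birkhoff–Witt theorem does not enter.
-/

namespace QueerW

noncomputable section

/-! ### Relations in the enveloping superalgebra -/

section Relations

variable {n : ℕ}

/-- The basis of `Q(n)`, indexed by parity: `e i j` for `ε = 0` and `f i j` for `ε = 1`. -/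
def basisElt (ε : Fin 2) (i j : Fin n) : Q n := if ε = 0 then e i j else f i j

theorem basisElt_mul (ε τ : Fin 2) (i j k m : Fin n) :
    basisElt ε i j * basisElt τ k m = if j = k then basisElt (ε + τ) i m else 0 := by
  apply Subtype.ext
  fin_cases ε <;> fin_cases τ <;> split_ifs with h <;>
    simp [basisElt, e, f, Matrix.fromBlocks_multiply, h]

theorem isHomogeneous_basisElt (ε : Fin 2) (i j : Fin n) : IsHomogeneous ε (basisElt ε i j) := by
  fin_cases ε <;> simp [basisElt, e, f, IsHomogeneous]

theorem span_basisElt :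
    Submodule.span ℂ {x : Q n | ∃ ε i j, x = basisElt ε i j} = ⊤ := by
  rw [eq_top_iff]
  rintro ⟨_, A, B, rfl⟩ -
  have h : (⟨Matrix.fromBlocks A B B A, A, B, rfl⟩ : Q n) =
      ∑ i, ∑ j, (A i j • basisElt 0 i j + B i j • basisElt 1 i j) := by
    apply Subtype.ext
    simp only [AddSubmonoidClass.coe_finsetSum, Subalgebra.coe_add, Subalgebra.coe_smul]
    ext (a | a) (b | b) <;>
      simp [basisElt, e, f, Matrix.sum_apply, Matrix.single_apply, ite_and]
  rw [h]
  refine Submodule.sum_mem _ fun i _ => Submodule.sum_mem _ fun j _ => Submodule.add_mem _ ?_ ?_ <;>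
    exact Submodule.smul_mem _ _ (Submodule.subset_span ⟨_, _, _, rfl⟩)

/-- The image of `basisElt` in the enveloping superalgebra. -/
def gen (ε : Fin 2) (i j : Fin n) : U n := ι n (basisElt ε i j)

/-- Sergeev's elements, indexed by parity: `eS` for `ε = 0` and `fS` for `ε = 1`. -/
def ser (ε : Fin 2) (m : ℕ) (i j : Fin n) : U n := if ε = 0 then eS m i j else fS m i j

/-- The sign `(-1)^(ετ)` of the exchange of factors of parities `ε` and `τ`. -/
def sgn (ε τ : Fin 2) : ℂ := (-1) ^ (ε.val * τ.val)

theorem sgn_mul_self (ε τ : Fin 2) : sgn ε τ * sgn ε τ = 1 := by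
  fin_cases ε <;> fin_cases τ <;> simp [sgn]

theorem gen_mul_gen (ε τ : Fin 2) (i j k m : Fin n) :
    gen ε i j * gen τ k m = sgn ε τ • (gen τ k m * gen ε i j) +
      ((if j = k then gen (ε + τ) i m else 0) -
        sgn ε τ • if m = i then gen (ε + τ) k j else 0) := by
  have h := ι_superbracket ε τ _ _ (isHomogeneous_basisElt ε i j) (isHomogeneous_basisElt τ k m)
  rw [superbracket, basisElt_mul, basisElt_mul, map_sub, map_smul, sub_eq_iff_eq_add'] at h
  rw [gen, gen, sgn, h]
  congr 2
  · split_ifs <;> simp [gen]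
  · rw [add_comm τ ε]; split_ifs <;> simp [gen]

theorem ser_zero (ε : Fin 2) (i j : Fin n) :
    ser ε 0 i j = if ε = 0 ∧ i = j then 1 else 0 := by
  fin_cases ε <;> simp [ser, eS, fS, sergeev]

theorem ser_succ (ε : Fin 2) (m : ℕ) (i j : Fin n) :
    ser ε (m + 1) i j = ∑ k, gen 0 i k * ser ε m k j +
      (-1 : ℂ) ^ m • ∑ k, gen 1 i k * ser (ε + 1) m k j := by
  fin_cases ε <;> simp [ser, eS, fS, sergeev, gen, basisElt, Algebra.smul_def, pow_succ]

/-- The recursion as one sum, over the parity `y.1` and the target `y.2` of the first step. -/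
theorem ser_succ_eq_sum_prod (ε : Fin 2) (m : ℕ) (i j : Fin n) :
    ser ε (m + 1) i j = ∑ y : Fin 2 × Fin n,
      (-1 : ℂ) ^ (y.1.val * m) • (gen y.1 i y.2 * ser (ε + y.1) m y.2 j) := by
  rw [ser_succ, Fintype.sum_prod_type, Fin.sum_univ_two]
  simp [Finset.smul_sum]

theorem super_leibniz {a x y P R : U n} {c d : ℂ} (hx : a * x = c • (x * a) + P)
    (hy : a * y = d • (y * a) + R) :
    a * (x * y) = (c * d) • (x * y * a) + (P * y + c • (x * R)) := by
  rw [← mul_assoc, hx, add_mul, smul_mul_assoc, mul_assoc, hy, mul_add, mul_smul_comm, smul_add,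
    smul_smul, mul_assoc, add_assoc, add_comm (P * y)]

/-- Sergeev's commutation relations: under the adjoint action, the elements `ser ε m k s` transform
like the matrix units, up to signs. -/
theorem gen_mul_ser (τ ε : Fin 2) (m : ℕ) (i j k s : Fin n) :
    gen τ i j * ser ε m k s = sgn τ ε • (ser ε m k s * gen τ i j) +
      (((-1 : ℂ) ^ (τ.val * (m + 1)) • if j = k then ser (τ + ε) m i s else 0) -
        sgn τ ε • if s = i then ser (τ + ε) m k j else 0) := by
  induction m generalizing τ ε i j k s with
  | zero =>
    fin_cases τ <;> fin_cases ε <;> simp [ser_zero, sgn] <;> split_ifs <;> simp_all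
  | succ m ih =>
    have h0 : ∀ t, gen τ i j * (gen 0 k t * ser ε m t s) = _ := fun t =>
      super_leibniz (gen_mul_gen τ 0 i j k t) (ih τ ε i j t s)
    have h1 : ∀ t, gen τ i j * (gen 1 k t * ser (ε + 1) m t s) = _ := fun t =>
      super_leibniz (gen_mul_gen τ 1 i j k t) (ih τ (ε + 1) i j t s)
    rw [ser_succ, mul_add, mul_smul_comm, Finset.mul_sum, Finset.mul_sum]
    simp only [h0, h1, sub_mul, mul_sub, ite_mul, zero_mul, mul_ite, mul_zero, smul_mul_assoc,
      mul_smul_comm, Finset.sum_add_distrib, Finset.sum_sub_distrib, ← Finset.smul_sum, smul_sub,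
      Finset.sum_ite_eq, Finset.sum_ite_eq', Finset.mem_univ, if_true, ser_succ, add_mul,
      Finset.sum_mul]
    -- The inner terms of the two sums cancel; only signs depending on the parity of `m` are left.
    rcases neg_one_pow_eq_or ℂ m with hm | hm <;>
    fin_cases τ <;> fin_cases ε <;> by_cases h3 : j = k <;> by_cases h4 : s = i <;>
      simp [sgn, h3, h4, pow_succ, hm] <;> abel

end Relations

/-! ### The character and Whittaker vectors in coordinates -/

section Character

variable {r l : ℕ}

/-- The block containing an index. -/
def blk (a : Fin (r * l)) : Fin r := (finProdFinEquiv.symm a).1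

/-- The position, counted from `0`, of an index within its block. -/
def pos (a : Fin (r * l)) : ℕ := (finProdFinEquiv.symm a).2

theorem pos_lt (a : Fin (r * l)) : pos a < l := (finProdFinEquiv.symm a).2.2

@[simp] theorem blk_idx (p : Fin r) (i : Fin l) : blk (idx p i) = p := by simp [blk, idx]

@[simp] theorem pos_idx (p : Fin r) (i : Fin l) : pos (idx p i) = i := by simp [pos, idx]

theorem idx_blk_pos (a : Fin (r * l)) : idx (blk a) ⟨pos a, pos_lt a⟩ = a :=
  finProdFinEquiv.apply_symm_apply a

theorem index_ext_iff {a b : Fin (r * l)} : a = b ↔ blk a = blk b ∧ pos a = pos b := by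
  refine ⟨fun h => by simp [h], fun ⟨h1, h2⟩ => ?_⟩
  rw [← idx_blk_pos a, ← idx_blk_pos b]
  congr 1
  exact Fin.ext h2

theorem otr_basisElt (ε : Fin 2) (a b : Fin (r * l)) :
    otr (basisElt ε a b) = if ε = 1 ∧ a = b then 1 else 0 := by
  fin_cases ε
  · simp [otr, basisElt, e]
  · by_cases h : a = b
    · subst h; simp [otr, basisElt, f]
    · simp [otr, basisElt, f, h, Matrix.trace_single_eq_of_ne]

theorem otr_add (x y : Q (r * l)) : otr (x + y) = otr x + otr y := by
  simp [otr, ← Matrix.trace_add]; rfl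

theorem otr_smul (c : ℂ) (x : Q (r * l)) : otr (c • x) = c * otr x := by
  simp [otr, Matrix.trace, Matrix.toBlocks₁₂, Finset.mul_sum]

variable (r l) in
/-- The functional `χ` as a linear map. -/
def χLin : Q (r * l) →ₗ[ℂ] ℂ where
  toFun := χ r l
  map_add' x y := by rw [χ, χ, χ, add_mul, otr_add]
  map_smul' c x := by rw [χ, χ, smul_mul_assoc, otr_smul]; rfl

/-- `χ` in coordinates: it sees only the even steps by one position down within a block. -/
theorem χ_basisElt (ε : Fin 2) (a b : Fin (r * l)) :
    χ r l (basisElt ε a b) = if ε = 0 ∧ blk a = blk b ∧ pos a = pos b + 1 then 1 else 0 := by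
  have h1 : ∀ x : Q (r * l), otr x = (⟨⟨otr, otr_add⟩, otr_smul⟩ : Q (r * l) →ₗ[ℂ] ℂ) x :=
    fun _ => rfl
  have h2 : ∀ (p : Fin r) (i : Fin (l - 1)),
      otr (basisElt ε a b * f (idx p (⟨i.val, by omega⟩ : Fin l))
        (idx p (⟨i.val + 1, by omega⟩ : Fin l))) =
      if ε = 0 ∧ blk b = p ∧ pos b = i ∧ blk a = p ∧ pos a = i + 1 then 1 else 0 := by
    intro p i
    rw [show (f (idx p (⟨i.val, by omega⟩ : Fin l)) (idx p (⟨i.val + 1, by omega⟩ : Fin l))) =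
      basisElt 1 (idx p (⟨i.val, by omega⟩ : Fin l)) (idx p (⟨i.val + 1, by omega⟩ : Fin l))
      by simp [basisElt], basisElt_mul]
    have h3 : ε + 1 = 1 ↔ ε = 0 := by fin_cases ε <;> simp
    split_ifs with h4 h5 h5
    · rw [otr_basisElt, if_pos]
      exact ⟨h3.2 h5.1, index_ext_iff.2 (by simp [h5])⟩
    · rw [otr_basisElt, if_neg]
      rintro ⟨h6, rfl⟩
      exact h5 ⟨h3.1 h6, by simp [h4], by simp [h4], by simp, by simp⟩
    · exact absurd (index_ext_iff.2 (by simp [h5])) h4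
    · rw [h1, map_zero]
  rw [χ, E, Finset.mul_sum]
  simp only [Finset.mul_sum]
  rw [h1]
  simp only [map_sum]
  simp only [← h1, h2]
  split_ifs with h
  · have hb : pos b < l - 1 := by have := pos_lt a; omega
    rw [Finset.sum_eq_single (blk a), Finset.sum_eq_single ⟨pos b, hb⟩, if_pos]
    · simp [h]
    · intro i _ hi
      rw [if_neg]
      rintro ⟨-, -, h7, -⟩
      exact hi (Fin.ext h7.symm)
    · simp
    · intro p _ hp
      refine Finset.sum_eq_zero fun i _ => if_neg ?_
      rintro ⟨-, -, -, h7, -⟩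
      exact hp h7.symm
    · simp
  · refine Finset.sum_eq_zero fun p _ => Finset.sum_eq_zero fun i _ => if_neg ?_
    rintro ⟨h3, h4, h5, h6, h7⟩
    exact h ⟨h3, by rw [h4, h6], by rw [h5, h7]⟩

theorem basisElt_mem_𝔪 {ε : Fin 2} {a b : Fin (r * l)} (h : pos b < pos a) :
    basisElt ε a b ∈ 𝔪 r l := by
  have ha := pos_lt a
  refine Submodule.mem_iSup_of_mem (pos a - pos b) (Submodule.mem_iSup_of_mem
    (Finset.mem_Icc.2 (by omega)) (Submodule.subset_span
      ⟨blk a, blk b, ⟨pos a, ha⟩, ⟨pos b, pos_lt b⟩, ?_, ?_⟩))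
  · rw [Nat.cast_sub h.le]; ring
  · rw [idx_blk_pos, idx_blk_pos]
    fin_cases ε <;> simp [basisElt]

theorem 𝔪_le {V : Submodule ℂ (Q (r * l))}
    (h : ∀ ε (a b : Fin (r * l)), pos b < pos a → basisElt ε a b ∈ V) : 𝔪 r l ≤ V := by
  refine iSup₂_le fun k hk => Submodule.span_le.2 ?_
  rintro x ⟨p, q, i, j, hij, hx⟩
  have hk := (Finset.mem_Icc.1 hk).1
  have hlt : pos (idx q j) < pos (idx p i) := by rw [pos_idx, pos_idx]; omega
  rcases hx with rfl | rfl
  · exact h 0 _ _ hlt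
  · exact h 1 _ _ hlt

theorem gen_smul_π_one {ε : Fin 2} {a b : Fin (r * l)} (h : pos b < pos a) :
    gen ε a b • π r l 1 = χ r l (basisElt ε a b) • π r l 1 :=
  ι_smul_π_one (basisElt_mem_𝔪 h)

theorem mem_whittakerVectors_iff {u : Whit r l} : u ∈ whittakerVectors r l ↔
    ∀ ε (a b : Fin (r * l)), pos b < pos a →
      gen ε a b • u = χ r l (basisElt ε a b) • u := by
  refine ⟨fun h ε a b hab => h _ (basisElt_mem_𝔪 hab), fun h => ?_⟩
  have h1 : 𝔪 r l ≤ LinearMap.ker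
      (((Algebra.lsmul ℂ ℂ (Whit r l)).toLinearMap ∘ₗ ι (r * l)).flip u -
        (χLin r l).smulRight u) := by
    refine 𝔪_le fun ε a b hab => ?_
    rw [LinearMap.mem_ker, LinearMap.sub_apply, sub_eq_zero]
    exact h ε a b hab
  intro a ha
  exact sub_eq_zero.1 (LinearMap.mem_ker.1 (h1 ha))

/-- Sergeev's elements from the last to the first positions supercommute with `𝔪`. -/
theorem gen_mul_ser_of_lt {τ ε : Fin 2} {m : ℕ} {a b c d : Fin (r * l)} (h : pos b < pos a)
    (hc : pos c + 1 = l) (hd : pos d = 0) :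
    gen τ a b * ser ε m c d = sgn τ ε • (ser ε m c d * gen τ a b) := by
  have ha := pos_lt a
  rw [gen_mul_ser, if_neg, if_neg]
  · simp
  · rintro rfl; omega
  · rintro rfl; omega

/-- Since `χ` vanishes on odd elements, moving a factor past `a` does not change `χ(a)`. -/
theorem sgn_smul_χ (τ ε : Fin 2) (a b : Fin (r * l)) :
    sgn τ ε * χ r l (basisElt τ a b) = χ r l (basisElt τ a b) := by
  rw [χ_basisElt]
  split_ifs with h
  · simp [sgn, h]
  · simp

theorem sgn_smul_smul_sub (τ ε : Fin 2) (a b : Fin (r * l)) (x : U (r * l)) (v u : Whit r l) :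
    sgn τ ε • x • (v - χ r l (basisElt τ a b) • u) =
      sgn τ ε • x • v - χ r l (basisElt τ a b) • x • u := by
  rw [smul_sub, smul_sub, smul_comm x (χ r l (basisElt τ a b)) u, smul_smul (sgn τ ε)
    (χ r l (basisElt τ a b)), sgn_smul_χ]

theorem ser_smul_mem_whittakerVectors {ε : Fin 2} {m : ℕ} {c d : Fin (r * l)}
    (hc : pos c + 1 = l) (hd : pos d = 0) {u : Whit r l} (hu : u ∈ whittakerVectors r l) :
    ser ε m c d • u ∈ whittakerVectors r l := by
  rw [mem_whittakerVectors_iff] at hu ⊢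
  intro τ a b hab
  rw [← mul_smul, gen_mul_ser_of_lt hab hc hd, smul_assoc, mul_smul, hu τ a b hab,
    smul_comm (ser ε m c d) (χ r l (basisElt τ a b)) u, smul_smul, sgn_smul_χ]

theorem π_one_mem_whittakerVectors : π r l 1 ∈ whittakerVectors r l :=
  mem_whittakerVectors_iff.2 fun _ _ _ h => gen_smul_π_one h

end Character

/-! ### The Kazhdan filtration -/

section Filtration

variable {r l : ℕ}

variable (r l) in
/-- The elements of `U(Q(n))` out of which words are formed: the basis elements of `Q(n)` and
Sergeev's elements. -/
inductive Letter : Type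
  | lin (ε : Fin 2) (a b : Fin (r * l))
  | ser (ε : Fin 2) (m : ℕ) (a b : Fin (r * l))

namespace Letter

/-- The element of `U(Q(n))` denoted by a letter. -/
def elt : Letter r l → U (r * l)
  | lin ε a b => gen ε a b
  | ser ε m a b => QueerW.ser ε m a b

/-- Half the Kazhdan degree of a letter: an element of `𝔤_{2d}` has degree `d + 1`. -/
def deg : Letter r l → ℤ
  | lin _ a b => pos b - pos a + 1
  | ser _ m a b => pos b - pos a + m

end Letter

/-- The vector of the Whittaker module given by a product of letters. -/
def wordVec (w : List (Letter r l)) : Whit r l := (w.map Letter.elt).prod • π r l 1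

/-- The total degree of a word. -/
def wordDeg (w : List (Letter r l)) : ℤ := (w.map Letter.deg).sum

@[simp] theorem wordVec_nil : wordVec ([] : List (Letter r l)) = π r l 1 := by simp [wordVec]

@[simp] theorem wordVec_cons (x : Letter r l) (w : List (Letter r l)) :
    wordVec (x :: w) = x.elt • wordVec w := by simp [wordVec, mul_smul]

@[simp] theorem wordDeg_nil : wordDeg ([] : List (Letter r l)) = 0 := by simp [wordDeg]

@[simp] theorem wordDeg_cons (x : Letter r l) (w : List (Letter r l)) :
    wordDeg (x :: w) = x.deg + wordDeg w := by simp [wordDeg]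

/-- The span of the words of degree at most `d` in the letters from `L`. -/
def wordSpan (L : Set (Letter r l)) (d : ℤ) : Submodule ℂ (Whit r l) :=
  Submodule.span ℂ {u | ∃ w : List (Letter r l), (∀ x ∈ w, x ∈ L) ∧ wordDeg w ≤ d ∧ wordVec w = u}

theorem wordVec_mem {L : Set (Letter r l)} {d : ℤ} {w : List (Letter r l)}
    (h : ∀ x ∈ w, x ∈ L) (hd : wordDeg w ≤ d) : wordVec w ∈ wordSpan L d :=
  Submodule.subset_span ⟨w, h, hd, rfl⟩

theorem wordSpan_mono {L L' : Set (Letter r l)} {d d' : ℤ} (h : L ⊆ L') (hd : d ≤ d') :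
    wordSpan L d ≤ wordSpan L' d' := by
  refine Submodule.span_mono ?_
  rintro _ ⟨w, hw, hwd, rfl⟩
  exact ⟨w, fun x hx => h (hw x hx), hwd.trans hd, rfl⟩

/-- The action of an element of `U(Q(n))` as a complex linear map. -/
def act (x : U (r * l)) : Whit r l →ₗ[ℂ] Whit r l := Algebra.lsmul ℂ ℂ (Whit r l) x

@[simp] theorem act_apply (x : U (r * l)) (u : Whit r l) : act x u = x • u := rfl

theorem map_mem_of_forall_word {L : Set (Letter r l)} {d : ℤ} {V : Submodule ℂ (Whit r l)}
    (φ : Whit r l →ₗ[ℂ] Whit r l)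
    (h : ∀ w : List (Letter r l), (∀ x ∈ w, x ∈ L) → wordDeg w ≤ d → φ (wordVec w) ∈ V)
    {u : Whit r l} (hu : u ∈ wordSpan L d) : φ u ∈ V := by
  have h1 : wordSpan L d ≤ V.comap φ := by
    refine Submodule.span_le.2 ?_
    rintro _ ⟨w, hw, hd, rfl⟩
    exact h w hw hd
  exact h1 hu

theorem elt_smul_mem_wordSpan {L : Set (Letter r l)} {d d' : ℤ} {x : Letter r l} (hx : x ∈ L)
    {u : Whit r l} (hu : u ∈ wordSpan L d) (h : x.deg + d ≤ d') :
    x.elt • u ∈ wordSpan L d' := by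
  refine map_mem_of_forall_word (act x.elt) (fun w hw hd => ?_) hu
  rw [act_apply, ← wordVec_cons]
  refine wordVec_mem (fun y hy => ?_) ?_
  · rcases List.mem_cons.1 hy with rfl | hy
    exacts [hx, hw y hy]
  · rw [wordDeg_cons]; omega

variable (r l) in
/-- The basis elements of the nonnegative part of the Dynkin grading, as letters. -/
def nonnegLetters : Set (Letter r l) := {x | ∃ ε a b, pos a ≤ pos b ∧ x = .lin ε a b}

variable (r l) in
/-- The Kazhdan filtration of the Whittaker module. -/
def filt (d : ℤ) : Submodule ℂ (Whit r l) := wordSpan (nonnegLetters r l) d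

theorem filt_mono {d d' : ℤ} (h : d ≤ d') : filt r l d ≤ filt r l d' :=
  wordSpan_mono subset_rfl h

theorem π_one_mem_filt {d : ℤ} (h : 0 ≤ d) : π r l 1 ∈ filt r l d := by
  rw [← wordVec_nil]; exact wordVec_mem (by simp) (by simpa using h)

theorem wordDeg_nonneg {w : List (Letter r l)} (h : ∀ x ∈ w, x ∈ nonnegLetters r l) :
    0 ≤ wordDeg w := by
  refine List.sum_nonneg fun y hy => ?_
  obtain ⟨x, hx, rfl⟩ := List.mem_map.1 hy
  obtain ⟨ε, a, b, hab, rfl⟩ := h x hx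
  simp only [Letter.deg]; omega

theorem filt_eq_bot {d : ℤ} (h : d < 0) : filt r l d = ⊥ := by
  rw [filt, wordSpan, Submodule.span_eq_bot]
  rintro _ ⟨w, hw, hd, rfl⟩
  have := wordDeg_nonneg hw
  omega

theorem gen_smul_gen_smul (ε τ : Fin 2) (i j k m : Fin (r * l)) (u : Whit r l) :
    gen ε i j • gen τ k m • u = sgn ε τ • gen τ k m • gen ε i j • u +
      ((if j = k then gen (ε + τ) i m • u else 0) -
        sgn ε τ • if m = i then gen (ε + τ) k j • u else 0) := by
  rw [← mul_smul, gen_mul_gen, add_smul, smul_assoc, mul_smul, sub_smul, smul_assoc, ite_smul,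
    ite_smul, zero_smul]

theorem gen_smul_mem_of_le (ε : Fin 2) {a b : Fin (r * l)} (hab : pos a ≤ pos b) {u : Whit r l}
    {j d : ℤ} (hu : u ∈ filt r l j) (hd : j + (pos b - pos a + 1) ≤ d) :
    gen ε a b • u ∈ filt r l d :=
  elt_smul_mem_wordSpan (L := nonnegLetters r l) (x := .lin ε a b) ⟨ε, a, b, hab, rfl⟩ hu
    (by simp only [Letter.deg]; omega)

/-- An element of `𝔪` is moved to the right through the word. The commutators shorten the word, and
at `π(1)` it acts by `χ`, which vanishes unless the degree is zero. -/
theorem gen_smul_wordVec_mem (w : List (Letter r l)) (hw : ∀ x ∈ w, x ∈ nonnegLetters r l)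
    (ε : Fin 2) (a b : Fin (r * l)) {d : ℤ} (hd : wordDeg w + (pos b - pos a + 1) ≤ d) :
    gen ε a b • wordVec w ∈ filt r l d := by
  by_cases hab : pos a ≤ pos b
  · exact gen_smul_mem_of_le ε hab (wordVec_mem hw le_rfl) hd
  rw [not_le] at hab
  induction w generalizing ε a b d with
  | nil =>
    rw [wordVec_nil, gen_smul_π_one hab, χ_basisElt]
    split_ifs with h
    · rw [one_smul]
      exact π_one_mem_filt (by simp at hd; omega)
    · simp
  | cons x w ih =>
    have hw' : ∀ y ∈ w, y ∈ nonnegLetters r l := fun y hy => hw y (List.mem_cons_of_mem _ hy)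
    obtain ⟨τ, c, e, hce, rfl⟩ := hw x (List.mem_cons_self ..)
    have key : ∀ (ε : Fin 2) (a b : Fin (r * l)) {d : ℤ},
        wordDeg w + (pos b - pos a + 1) ≤ d → gen ε a b • wordVec w ∈ filt r l d := by
      intro ε a b d hd
      by_cases hab : pos a ≤ pos b
      · exact gen_smul_mem_of_le ε hab (wordVec_mem hw' le_rfl) hd
      · exact ih hw' ε a b hd (not_le.1 hab)
    rw [wordDeg_cons, Letter.deg] at hd
    rw [wordVec_cons, Letter.elt, gen_smul_gen_smul]
    refine add_mem (Submodule.smul_mem _ _ ?_) (sub_mem ?_ (Submodule.smul_mem _ _ ?_))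
    · exact gen_smul_mem_of_le τ hce (key ε a b le_rfl) (by omega)
    · split_ifs with h
      · subst h; exact key _ _ _ (by omega)
      · exact zero_mem _
    · split_ifs with h
      · subst h; exact key _ _ _ (by omega)
      · exact zero_mem _

/-- Every basis element of `Q(n)` respects the Kazhdan filtration, also those of negative
degree. -/
theorem gen_smul_mem (ε : Fin 2) (a b : Fin (r * l)) {u : Whit r l} {j d : ℤ}
    (hu : u ∈ filt r l j) (hd : j + (pos b - pos a + 1) ≤ d) : gen ε a b • u ∈ filt r l d :=
  map_mem_of_forall_word (act (gen ε a b))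
    (fun w hw hj => gen_smul_wordVec_mem w hw ε a b (by omega)) hu

/-- On the associated graded module, `𝔪` acts through `χ`. -/
theorem gen_smul_sub_mem (ε : Fin 2) {a b : Fin (r * l)} (hab : pos b < pos a) {u : Whit r l}
    {j d : ℤ} (hu : u ∈ filt r l j) (hd : j + (pos b - pos a) ≤ d) :
    gen ε a b • u - χ r l (basisElt ε a b) • u ∈ filt r l d := by
  refine map_mem_of_forall_word (act (gen ε a b) - χ r l (basisElt ε a b) • LinearMap.id)
    (fun w hw hj => ?_) hu
  simp only [LinearMap.sub_apply, act_apply, LinearMap.smul_apply, LinearMap.id_apply]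
  clear hu
  induction w generalizing d j with
  | nil => rw [wordVec_nil, gen_smul_π_one hab, sub_self]; exact zero_mem _
  | cons x w ih =>
    have hw' : ∀ y ∈ w, y ∈ nonnegLetters r l := fun y hy => hw y (List.mem_cons_of_mem _ hy)
    obtain ⟨τ, c, e, hce, rfl⟩ := hw x (List.mem_cons_self ..)
    rw [wordDeg_cons, Letter.deg] at hj
    have hwm : wordVec w ∈ filt r l (wordDeg w) := wordVec_mem hw' le_rfl
    rw [wordVec_cons, Letter.elt, gen_smul_gen_smul, add_sub_right_comm]
    rw [← sgn_smul_smul_sub]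
    refine add_mem (Submodule.smul_mem _ _ ?_) (sub_mem ?_ (Submodule.smul_mem _ _ ?_))
    · exact gen_smul_mem τ c e (ih (j := wordDeg w) le_rfl hw' le_rfl) (by omega)
    · split_ifs with h
      · subst h; exact gen_smul_mem _ _ _ hwm (by omega)
      · exact zero_mem _
    · split_ifs with h
      · subst h; exact gen_smul_mem _ _ _ hwm (by omega)
      · exact zero_mem _

theorem ser_succ_smul (ε : Fin 2) (m : ℕ) (i j : Fin (r * l)) (u : Whit r l) :
    ser ε (m + 1) i j • u = ∑ y : Fin 2 × Fin (r * l),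
      (-1 : ℂ) ^ (y.1.val * m) • gen y.1 i y.2 • ser (ε + y.1) m y.2 j • u := by
  rw [ser_succ_eq_sum_prod, Finset.sum_smul]
  simp only [smul_assoc, mul_smul]

theorem ser_smul_mem (ε : Fin 2) (m : ℕ) (a b : Fin (r * l)) {u : Whit r l} {j d : ℤ}
    (hu : u ∈ filt r l j) (hd : j + (pos b - pos a + m) ≤ d) : ser ε m a b • u ∈ filt r l d := by
  induction m generalizing ε a d with
  | zero =>
    rw [ser_zero]
    split_ifs with h
    · rw [one_smul]
      rw [h.2] at hd
      exact filt_mono (by simpa using hd) hu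
    · rw [zero_smul]; exact zero_mem _
  | succ m ih =>
    rw [ser_succ_smul]
    refine sum_mem fun y _ => Submodule.smul_mem _ _ ?_
    exact gen_smul_mem _ _ _ (ih _ y.2 le_rfl) (by push_cast at hd; omega)

end Filtration

/-! ### Symbols of Sergeev's elements -/

section Symbols

variable {r l : ℕ}

theorem χ_basisElt_of_pos_lt {ε : Fin 2} {a b : Fin (r * l)} (h : pos b + 1 < pos a) :
    χ r l (basisElt ε a b) = 0 := by
  rw [χ_basisElt, if_neg]
  rintro ⟨-, -, h'⟩
  omega

/-- Sergeev's elements of negative degree vanish on the associated graded module. -/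
theorem ser_smul_mem_of_lt (ε : Fin 2) (m : ℕ) {a b : Fin (r * l)} (hb : pos b = 0)
    (hm : m < pos a) {u : Whit r l} {j d : ℤ} (hu : u ∈ filt r l j) (hd : j + (m - pos a) - 1 ≤ d) :
    ser ε m a b • u ∈ filt r l d := by
  induction m generalizing ε a d with
  | zero =>
    rw [ser_zero, if_neg, zero_smul]
    · exact zero_mem _
    · rintro ⟨-, rfl⟩; omega
  | succ m ih =>
    rw [ser_succ_smul]
    refine sum_mem fun y _ => Submodule.smul_mem _ _ ?_
    push_cast at hd
    by_cases h : m < pos y.2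
    · exact gen_smul_mem _ _ _ (ih _ h le_rfl) (by omega)
    · have h1 := gen_smul_sub_mem y.1 (a := a) (b := y.2) (by omega)
        (ser_smul_mem (ε + y.1) m y.2 b hu le_rfl) (d := d) (by omega)
      rwa [χ_basisElt_of_pos_lt (by omega), zero_smul, sub_zero] at h1

theorem sub_mem_of_sum_mem {κ M : Type*} [Fintype κ] [AddCommGroup M] [Module ℂ M]
    {V : Submodule ℂ M} (g : κ → M) (y₀ : κ) (h : ∀ y, y ≠ y₀ → g y ∈ V) :
    ∑ y, g y - g y₀ ∈ V := by
  classical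
  rw [← Finset.add_sum_erase _ _ (Finset.mem_univ y₀), add_sub_cancel_left]
  exact sum_mem fun y hy => h y (Finset.ne_of_mem_erase hy)

/-- Sergeev's elements of degree zero act by scalars on the associated graded module. -/
theorem ser_smul_sub_mem (ε : Fin 2) {a b : Fin (r * l)} (hb : pos b = 0) {u : Whit r l} {j d : ℤ}
    (hu : u ∈ filt r l j) (hd : j - 1 ≤ d) :
    ser ε (pos a) a b • u - (if ε = 0 ∧ blk a = blk b then u else 0) ∈ filt r l d := by
  obtain ⟨m, hm⟩ : ∃ m, m = pos a := ⟨_, rfl⟩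
  rw [← hm]
  induction m generalizing ε a with
  | zero =>
    rw [ser_zero, ite_smul, one_smul, zero_smul]
    have : a = b ↔ blk a = blk b := by rw [index_ext_iff, ← hm, hb]; simp
    simp [this]
  | succ m ih =>
    have hml : m < l := by have := pos_lt a; omega
    let y₀ : Fin 2 × Fin (r * l) := (0, idx (blk a) ⟨m, hml⟩)
    have h1 := sub_mem_of_sum_mem (V := filt r l d) (fun y : Fin 2 × Fin (r * l) =>
      (-1 : ℂ) ^ (y.1.val * m) • gen y.1 a y.2 • ser (ε + y.1) m y.2 b • u) y₀ (by
        intro y hy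
        refine Submodule.smul_mem _ _ ?_
        rcases lt_or_ge m (pos y.2) with h | h
        · exact gen_smul_mem _ _ _ (ser_smul_mem_of_lt _ _ hb h hu le_rfl) (by omega)
        · have h1 := gen_smul_sub_mem y.1 (a := a) (b := y.2) (by omega)
            (ser_smul_mem (ε + y.1) m y.2 b hu le_rfl) (d := d) (by omega)
          rwa [χ_basisElt, if_neg, zero_smul, sub_zero] at h1
          rintro ⟨h2, h3, h4⟩
          refine hy (Prod.ext h2 (index_ext_iff.2 ?_))
          simp only [y₀, blk_idx, pos_idx]
          exact ⟨h3.symm, by omega⟩)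
    rw [← ser_succ_smul] at h1
    have h2 := gen_smul_sub_mem 0 (a := a) (b := y₀.2) (by simp [y₀]; omega)
      (ser_smul_mem ε m y₀.2 b hu le_rfl) (d := d) (by simp [y₀]; omega)
    have h3 := ih ε (a := y₀.2) (by simp [y₀])
    rw [χ_basisElt, if_pos (by simp [y₀, hm]), one_smul] at h2
    have h4 : blk y₀.2 = blk a := by simp [y₀]
    rw [h4] at h3
    have := add_mem (add_mem h1 h2) h3
    simpa [y₀] using this

/-- The terms of the recursion for Sergeev's elements, modulo a subspace `V` containing what is of
lower degree or decomposable, that is, led by an element of smaller positive degree: only a step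
down along a Jordan block, and a single step to the final block followed by a walk down to its
first position, survive. -/
theorem gen_smul_ser_smul_sub_mem (τ ε : Fin 2) (m : ℕ) {a b c : Fin (r * l)} (hb : pos b = 0)
    (ham : pos a ≤ m) {u : Whit r l} {j : ℤ} (hu : u ∈ filt r l j) {V : Submodule ℂ (Whit r l)}
    (hV : filt r l (j + (m - pos a)) ≤ V)
    (hVgen : ∀ (ε : Fin 2) (c : Fin (r * l)) (v : Whit r l), pos a ≤ pos c →
      v ∈ filt r l (j + (m - pos c)) → pos c < m → gen ε a c • v ∈ V) :
    gen τ a c • ser (ε + τ) m c b • u -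
      (if τ = 0 ∧ blk a = blk c ∧ pos a = pos c + 1 then ser ε m c b • u else 0) -
      (if pos c = m ∧ ε + τ = 0 ∧ blk c = blk b then gen τ a c • u else 0) ∈ V := by
  rcases lt_or_ge (pos c) (pos a) with h | h
  · rw [if_neg (c := pos c = m ∧ _) (by omega), sub_zero]
    have h1 := gen_smul_sub_mem τ h (ser_smul_mem (ε + τ) m c b hu le_rfl)
      (d := j + (m - pos a)) (by omega)
    rw [χ_basisElt] at h1
    convert hV h1 using 2
    split_ifs with h2
    · rw [h2.1, add_zero, one_smul]
    · rw [zero_smul]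
  · rw [if_neg (by omega), sub_zero]
    rcases lt_trichotomy (pos c) m with h1 | rfl | h1
    · rw [if_neg (by omega), sub_zero]
      exact hVgen _ _ _ h (ser_smul_mem _ _ _ _ hu (by omega)) h1
    · have h2 := gen_smul_mem τ a c (ser_smul_sub_mem (ε + τ) (a := c) hb hu le_rfl)
        (d := j + (pos c - pos a)) (by omega)
      convert hV h2 using 1
      rw [smul_sub, smul_ite, smul_zero]
      simp
    · rw [if_neg (by omega), sub_zero]
      exact hV (gen_smul_mem _ _ _ (ser_smul_mem_of_lt _ _ hb h1 hu le_rfl) (by omega))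

end Symbols

/-! ### Spanning by the generators and a complement -/

section Spanning

variable {r l : ℕ}

theorem fin_two_add_eq_zero_iff {ε τ : Fin 2} : ε + τ = 0 ↔ τ = ε := by
  fin_cases ε <;> fin_cases τ <;> simp

/-- Away from the last positions, Sergeev's elements of degree `D + 1` to a first position act by
what is of lower degree, decomposable, or led by a basis element not ending at a last position. -/
theorem ser_smul_mem_of_trim {D : ℕ} {b : Fin (r * l)} (hb : pos b = 0) {u : Whit r l} {j : ℤ}
    (hu : u ∈ filt r l j) {V : Submodule ℂ (Whit r l)} (hV : filt r l (j + D) ≤ V)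
    (hVgen : ∀ (ε : Fin 2) (a c : Fin (r * l)) (v : Whit r l), pos a ≤ pos c →
      v ∈ filt r l (j + (pos a + D - pos c)) → pos c < pos a + D → gen ε a c • v ∈ V)
    (hVtrim : ∀ (ε : Fin 2) (a c : Fin (r * l)), pos c = pos a + D → pos c + 1 < l →
      gen ε a c • u ∈ V)
    (ε : Fin 2) {a : Fin (r * l)} (ha : pos a + D + 1 < l) :
    ser ε (pos a + D + 1) a b • u ∈ V := by
  obtain ⟨i, hi⟩ : ∃ i, i = pos a := ⟨_, rfl⟩
  induction i generalizing ε a with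
  | zero =>
    rw [ser_succ_smul]
    refine sum_mem fun y _ => Submodule.smul_mem _ _ ?_
    have h := gen_smul_ser_smul_sub_mem y.1 ε (pos a + D) (a := a) (c := y.2) hb (by omega) hu
      (V := V) (le_trans (filt_mono (by push_cast; omega)) hV)
      (fun ε c v h1 h2 h3 => hVgen ε a c v h1 (by push_cast at h2; exact h2) h3)
    rw [if_neg (by omega), sub_zero] at h
    refine (Submodule.sub_mem_iff_left _ ?_).1 h
    split_ifs with h1
    · exact hVtrim _ _ _ h1.1 (by omega)
    · exact zero_mem _
  | succ i ih =>
    rw [ser_succ_smul]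
    refine sum_mem fun y _ => Submodule.smul_mem _ _ ?_
    have h := gen_smul_ser_smul_sub_mem y.1 ε (pos a + D) (a := a) (c := y.2) hb (by omega) hu
      (V := V) (le_trans (filt_mono (by push_cast; omega)) hV)
      (fun ε c v h1 h2 h3 => hVgen ε a c v h1 (by push_cast at h2; exact h2) h3)
    refine (Submodule.sub_mem_iff_left _ ?_).1 ((Submodule.sub_mem_iff_left _ ?_).1 h)
    · split_ifs with h1
      · have h2 := ih ε (a := y.2) (by omega) (by omega)
        rwa [show pos y.2 + D + 1 = pos a + D by omega] at h2
      · exact zero_mem _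
    · split_ifs with h1
      · exact hVtrim _ _ _ h1.1 (by omega)
      · exact zero_mem _

/-- The symbol of a generator of `W_χ` of degree `D + 1` is linear modulo decomposables, and
involves the basis element between the position `l - 1 - D` and the last one. -/
theorem exists_ser_smul_sub_mem {D : ℕ} {b : Fin (r * l)} (hb : pos b = 0) {u : Whit r l} {j : ℤ}
    (hu : u ∈ filt r l j) {V : Submodule ℂ (Whit r l)} (hV : filt r l (j + D) ≤ V)
    (hVgen : ∀ (ε : Fin 2) (a c : Fin (r * l)) (v : Whit r l), pos a ≤ pos c →
      v ∈ filt r l (j + (pos a + D - pos c)) → pos c < pos a + D → gen ε a c • v ∈ V)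
    (hVtrim : ∀ (ε : Fin 2) (a c : Fin (r * l)), pos c = pos a + D → pos c + 1 < l →
      gen ε a c • u ∈ V)
    (ε : Fin 2) {a a' b' : Fin (r * l)} (ha : l ≤ pos a + D + 1) (hD : pos a' + D + 1 = l)
    (haa' : blk a = blk a') (hb' : pos b' + 1 = l) (hbb' : blk b = blk b') :
    ∃ s : ℂ, s ≠ 0 ∧ ser ε (pos a + D + 1) a b • u - s • gen ε a' b' • u ∈ V := by
  obtain ⟨i, hi⟩ : ∃ i, i = pos a := ⟨_, rfl⟩
  induction i using Nat.strong_induction_on generalizing a with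
  | _ i ih =>
    have h0 := fun y : Fin 2 × Fin (r * l) =>
      gen_smul_ser_smul_sub_mem y.1 ε (pos a + D) (a := a) (c := y.2) hb (by omega) hu
      (V := V) (le_trans (filt_mono (by push_cast; omega)) hV)
      (fun ε c v h1 h2 h3 => hVgen ε a c v h1 (by push_cast at h2; exact h2) h3)
    -- If `pos a + D` is the last position, the single step to it is the term sought; beyond that,
    -- the term sought comes from the step down to the position before `a`.
    rcases eq_or_lt_of_le ha with ha | ha
    · refine ⟨(-1 : ℂ) ^ (ε.val * (pos a + D)), pow_ne_zero _ (by simp), ?_⟩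
      have h1 := sub_mem_of_sum_mem (V := V) (fun y : Fin 2 × Fin (r * l) =>
        (-1 : ℂ) ^ (y.1.val * (pos a + D)) • gen y.1 a y.2 •
          ser (ε + y.1) (pos a + D) y.2 b • u) (ε, b') (by
        intro y hy
        refine Submodule.smul_mem _ _ ?_
        have h := h0 y
        rw [if_neg (c := pos y.2 = _ ∧ _), sub_zero] at h
        · refine (Submodule.sub_mem_iff_left _ ?_).1 h
          split_ifs with h1
          · have h2 := ser_smul_mem_of_trim hb hu hV hVgen hVtrim ε (a := y.2) (by omega)
            rwa [show pos y.2 + D + 1 = pos a + D by omega] at h2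
          · exact zero_mem _
        · rintro ⟨h1, h2, h3⟩
          refine hy (Prod.ext (fin_two_add_eq_zero_iff.1 h2) (index_ext_iff.2 ⟨?_, ?_⟩))
          · rw [h3, hbb']
          · simp only; omega)
      rw [← ser_succ_smul] at h1
      have h2 := h0 (ε, b')
      have haeq : a = a' := index_ext_iff.2 ⟨haa', by omega⟩
      rw [if_neg (by simp only; omega), sub_zero, if_pos
        ⟨by simp only; omega, fin_two_add_eq_zero_iff.2 rfl, hbb'.symm⟩] at h2
      have h3 := add_mem h1 (Submodule.smul_mem _ ((-1 : ℂ) ^ (ε.val * (pos a + D))) h2)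
      rw [smul_sub, sub_add_sub_cancel] at h3
      rwa [haeq] at h3 ⊢
    · have hal := pos_lt a
      let c : Fin (r * l) := idx (blk a) ⟨pos a - 1, by omega⟩
      have hc : pos c + 1 = pos a := by simp only [c, pos_idx]; omega
      have hca : blk c = blk a := by simp [c]
      obtain ⟨s, hs, h⟩ := ih (pos c) (by omega) (a := c) (by omega) (by rw [hca, haa']) rfl
      refine ⟨s, hs, ?_⟩
      have h1 := sub_mem_of_sum_mem (V := V) (fun y : Fin 2 × Fin (r * l) =>
        (-1 : ℂ) ^ (y.1.val * (pos a + D)) • gen y.1 a y.2 •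
          ser (ε + y.1) (pos a + D) y.2 b • u) (0, c) (by
        intro y hy
        refine Submodule.smul_mem _ _ ?_
        have h := h0 y
        have hyl := pos_lt y.2
        rw [if_neg, if_neg, sub_zero, sub_zero] at h
        · exact h
        · omega
        · rintro ⟨h1, h2, h3⟩
          exact hy (Prod.ext h1 (index_ext_iff.2 ⟨by rw [← h2, hca], by simp only; omega⟩)))
      rw [← ser_succ_smul] at h1
      have h2 := h0 (0, c)
      rw [if_pos ⟨rfl, hca.symm, hc.symm⟩, if_neg (by simp only; omega), sub_zero] at h2
      rw [show pos c + D + 1 = pos a + D by omega] at h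
      have h3 := add_mem (add_mem h1 h2) h
      simpa using h3

variable (r l) in
/-- The index set of a complement, in the nonnegative part of `Q(n)`, to the linear parts of the
symbols of the generators of `W_χ`: the basis elements that do not end at a last position. -/
def trim : Finset (Fin 2 × Fin (r * l) × Fin (r * l)) :=
  Finset.univ.filter fun t => pos t.2.1 ≤ pos t.2.2 ∧ pos t.2.2 + 1 < l

theorem mem_trim {t : Fin 2 × Fin (r * l) × Fin (r * l)} :
    t ∈ trim r l ↔ pos t.2.1 ≤ pos t.2.2 ∧ pos t.2.2 + 1 < l := by simp [trim]

/-- The generators of `W_χ`, as letters. -/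
inductive IsWGen : Letter r l → Prop
  | intro (ε : Fin 2) (m : ℕ) (a b : Fin (r * l)) (ha : pos a + 1 = l) (hb : pos b = 0)
      (hm : l ≤ m) (hm' : m < 2 * l) : IsWGen (.ser ε m a b)

/-- The generators of `W_χ` together with the basis elements indexed by `T`. -/
def coordLetters (T : Finset (Fin 2 × Fin (r * l) × Fin (r * l))) : Set (Letter r l) :=
  {x | IsWGen x ∨ ∃ t ∈ T, x = .lin t.1 t.2.1 t.2.2}

theorem coordLetters_mono {T T' : Finset (Fin 2 × Fin (r * l) × Fin (r * l))} (h : T ⊆ T') :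
    coordLetters T ⊆ coordLetters T' := by
  rintro x (hx | ⟨t, ht, rfl⟩)
  exacts [Or.inl hx, Or.inr ⟨t, h ht, rfl⟩]

/-- A basis element of degree `D + 1` ending at a last position is replaced by a generator with the
same linear part; the remaining terms of the symbol start with elements of smaller degree, which
allows an induction on `D`. -/
theorem gen_smul_mem_wordSpan_trim {j : ℤ} {D : ℕ}
    (ih : ∀ i ≤ j + D, filt r l i ≤ wordSpan (coordLetters (trim r l)) i) (ε : Fin 2)
    {a c : Fin (r * l)} (hac : pos c = pos a + D) {u : Whit r l} (hu : u ∈ filt r l j) :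
    gen ε a c • u ∈ wordSpan (coordLetters (trim r l)) (j + D + 1) := by
  induction D using Nat.strong_induction_on generalizing ε a c j u with
  | _ D ihD =>
    have hVtrim : ∀ (ε : Fin 2) (a c : Fin (r * l)), pos c = pos a + D → pos c + 1 < l →
        gen ε a c • u ∈ wordSpan (coordLetters (trim r l)) (j + D + 1) := by
      intro ε a c hac hc
      refine elt_smul_mem_wordSpan (x := .lin ε a c)
        (Or.inr ⟨(ε, a, c), mem_trim.2 ⟨by simp only; omega, hc⟩, rfl⟩) (ih j (by omega) hu) ?_
      simp only [Letter.deg]; omega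
    have hcl := pos_lt c
    rcases lt_or_eq_of_le (Nat.succ_le_of_lt hcl) with hc | hc
    · exact hVtrim ε a c hac hc
    have hl : 0 < l := by omega
    obtain ⟨a₁, ha₁, hpa₁⟩ : ∃ a₁ : Fin (r * l), blk a₁ = blk a ∧ pos a₁ + 1 = l :=
      ⟨idx (blk a) ⟨l - 1, by omega⟩, by simp, by simp; omega⟩
    obtain ⟨b₁, hb₁, hpb₁⟩ : ∃ b₁ : Fin (r * l), blk b₁ = blk c ∧ pos b₁ = 0 :=
      ⟨idx (blk c) ⟨0, hl⟩, by simp, by simp⟩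
    obtain ⟨s, hs, h⟩ := exists_ser_smul_sub_mem (D := D)
      (V := wordSpan (coordLetters (trim r l)) (j + D + 1)) (b := b₁) (a := a₁) (a' := a) (b' := c)
      hpb₁ hu ((ih _ le_rfl).trans (wordSpan_mono subset_rfl (by omega)))
      (by
        intro ε a c v h1 h2 h3
        obtain ⟨k, hk⟩ := Nat.exists_eq_add_of_le h1
        refine wordSpan_mono subset_rfl ?_ (ihD k (by omega) (fun i hi => ih i ?_) ε hk h2) <;>
          rw [hk] at * <;> push_cast at * <;> omega)
      hVtrim ε (by omega) (by omega) ha₁ hc hb₁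
    have h1 : ser ε (pos a₁ + D + 1) a₁ b₁ • u ∈
        wordSpan (coordLetters (trim r l)) (j + D + 1) := by
      refine elt_smul_mem_wordSpan (x := .ser ε (pos a₁ + D + 1) a₁ b₁)
        (Or.inl ⟨_, _, _, _, hpa₁, hpb₁, by omega, by omega⟩) (ih j (by omega) hu) ?_
      simp only [Letter.deg]; push_cast; omega
    have h2 := (Submodule.sub_mem_iff_right _ h1).1 h
    exact (Submodule.smul_mem_iff _ hs).1 h2

/-- The Kazhdan filtration is spanned by the words in the generators of `W_χ` and the basis
elements indexed by `trim`. -/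
theorem filt_le_wordSpan_trim (d : ℤ) : filt r l d ≤ wordSpan (coordLetters (trim r l)) d := by
  have key : ∀ N : ℕ, ∀ d : ℤ, d < N → filt r l d ≤ wordSpan (coordLetters (trim r l)) d := by
    intro N
    induction N with
    | zero => intro d hd; rw [filt_eq_bot (by simpa using hd)]; exact bot_le
    | succ N ih =>
      intro d hd
      refine Submodule.span_le.2 ?_
      rintro _ ⟨w, hw, hwd, rfl⟩
      cases w with
      | nil => exact wordVec_mem (by simp) hwd
      | cons x w =>
        obtain ⟨ε, a, c, hac, rfl⟩ := hw x (List.mem_cons_self ..)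
        have hw' : ∀ y ∈ w, y ∈ nonnegLetters r l := fun y hy => hw y (List.mem_cons_of_mem _ hy)
        obtain ⟨D, hD⟩ := Nat.exists_eq_add_of_le hac
        rw [wordDeg_cons, Letter.deg] at hwd
        rw [wordVec_cons]
        push_cast at hd
        exact wordSpan_mono subset_rfl (by omega) (gen_smul_mem_wordSpan_trim
          (fun i hi => ih i (by omega)) ε hD (wordVec_mem hw' le_rfl))
  exact key (d.toNat + 1) d (by omega)

end Spanning

/-! ### Euler operators and elimination -/

section Euler

variable {r l : ℕ}

/-- The Euler operator `t (y - χ(y))` of the basis element `t` of parity `ε` at `(a, c)`. In use,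
`c'` is the successor of `c` in its block, and the element `y` of `𝔪` of parity `ε` at `(c', a)`
is dual to `t` in that `χ([y, t]) = 1`. -/
def euler (ε : Fin 2) (a c c' : Fin (r * l)) : Whit r l →ₗ[ℂ] Whit r l :=
  act (gen ε a c) ∘ₗ (act (gen ε c' a) - χ r l (basisElt ε c' a) • LinearMap.id)

theorem euler_apply (ε : Fin 2) (a c c' : Fin (r * l)) (u : Whit r l) :
    euler ε a c c' u = gen ε a c • (gen ε c' a • u - χ r l (basisElt ε c' a) • u) := rfl

theorem euler_mem {ε : Fin 2} {a c c' : Fin (r * l)} (hac : pos a ≤ pos c)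
    (hc : pos c' = pos c + 1) {u : Whit r l} {j : ℤ} (hu : u ∈ filt r l j) :
    euler ε a c c' u ∈ filt r l j :=
  gen_smul_mem _ _ _ (gen_smul_sub_mem ε (by omega) hu le_rfl) (by omega)

theorem euler_of_mem_whittakerVectors {ε : Fin 2} {a c c' : Fin (r * l)} (hac : pos a ≤ pos c)
    (hc : pos c' = pos c + 1) {u : Whit r l} (hu : u ∈ whittakerVectors r l) :
    euler ε a c c' u = 0 := by
  rw [euler_apply, mem_whittakerVectors_iff.1 hu _ _ _ (by omega), sub_self, smul_zero]

/-- Modulo lower degree, the Euler operator commutes with the generators of `W_χ`. -/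
theorem euler_ser_smul_sub_mem {ε τ : Fin 2} {a c c' : Fin (r * l)} (hac : pos a ≤ pos c)
    (hc : pos c' = pos c + 1) {m : ℕ} {p q : Fin (r * l)} (hp : pos p + 1 = l) (hq : pos q = 0)
    {u : Whit r l} {j d : ℤ} (hu : u ∈ filt r l j) (hd : j + (pos q - pos p + m) - 1 ≤ d) :
    euler ε a c c' (ser τ m p q • u) - ser τ m p q • euler ε a c c' u ∈ filt r l d := by
  have hv := gen_smul_sub_mem ε (a := c') (b := a) (by omega) hu le_rfl
  set v := gen ε c' a • u - χ r l (basisElt ε c' a) • u with hvdef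
  have h1 : gen ε c' a • ser τ m p q • u - χ r l (basisElt ε c' a) • ser τ m p q • u =
      sgn ε τ • ser τ m p q • v := by
    rw [← mul_smul, gen_mul_ser_of_lt (by omega) hp hq, smul_assoc, mul_smul, hvdef,
      sgn_smul_smul_sub]
  rw [euler_apply, euler_apply, h1, ← hvdef, smul_comm (gen ε a c) (sgn ε τ),
    ← mul_smul (gen ε a c), gen_mul_ser, add_smul, smul_add, smul_assoc, smul_smul, sgn_mul_self,
    one_smul, mul_smul, add_sub_cancel_left, sub_smul, smul_assoc, smul_assoc, ite_smul, ite_smul, zero_smul]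
  refine Submodule.smul_mem _ _ (sub_mem (Submodule.smul_mem _ _ ?_) (Submodule.smul_mem _ _ ?_))
  · split_ifs with h
    · subst h; exact ser_smul_mem _ _ _ _ hv (by omega)
    · exact zero_mem _
  · split_ifs with h
    · subst h; exact ser_smul_mem _ _ _ _ hv (by omega)
    · exact zero_mem _

/-- The duality behind the Euler operators: modulo lower degree, the bracket of the dual element of
`(ε, a, c)` with a basis element that does not exceed `(ε, a, c)` in the lexicographic order by
degree and starting position is `1` for `(ε, a, c)` itself, and `0` otherwise. -/
theorem bracket_smul_sub_mem {ε τ : Fin 2} {a c c' p q : Fin (r * l)}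
    (hcc : blk c' = blk c) (hc : pos c' = pos c + 1)
    (hle : pos q + pos a < pos c + pos p ∨ pos q + pos a = pos c + pos p ∧ pos p ≤ pos a)
    {u : Whit r l} {j d : ℤ} (hu : u ∈ filt r l j)
    (hd : j + (pos q - pos p - pos c + pos a - 1) ≤ d) :
    (if a = p then gen (ε + τ) c' q • u else 0) -
        sgn ε τ • (if q = c' then gen (ε + τ) p a • u else 0) -
      (if ε = τ ∧ a = p ∧ c = q then u else 0) ∈ filt r l d := by
  have h1 : (if q = c' then gen (ε + τ) p a • u else 0) ∈ filt r l d := by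
    split_ifs with h
    · subst h
      have h2 := gen_smul_sub_mem (ε + τ) (a := p) (b := a) (by omega) hu (d := d) (by omega)
      rwa [χ_basisElt_of_pos_lt (by omega), zero_smul, sub_zero] at h2
    · exact zero_mem _
  rw [sub_right_comm]
  refine sub_mem ?_ (Submodule.smul_mem _ _ h1)
  by_cases h : a = p
  · subst h
    have h2 := gen_smul_sub_mem (ε + τ) (a := c') (b := q) (by omega) hu (d := d) (by omega)
    rw [χ_basisElt] at h2
    have h3 : (ε + τ = 0 ∧ blk c' = blk q ∧ pos c' = pos q + 1) ↔ (ε = τ ∧ c = q) := by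
      rw [fin_two_add_eq_zero_iff, index_ext_iff, hcc, hc, add_left_inj, @eq_comm _ τ]
    simpa [h3, ite_smul] using h2
  · simp [h]

/-- Modulo lower degree, the Euler operator of `t` commutes with `t` up to `t` itself, and with
the other basis elements `t'` not exceeding `t` in the order of `bracket_smul_sub_mem`. The signs
from moving `t'` past `t` and past the dual of `t` cancel. -/
theorem euler_gen_smul_sub_mem {ε τ : Fin 2} {a c c' p q : Fin (r * l)} (hac : pos a ≤ pos c)
    (hcc : blk c' = blk c) (hc : pos c' = pos c + 1)
    (hle : pos q + pos a < pos c + pos p ∨ pos q + pos a = pos c + pos p ∧ pos p ≤ pos a)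
    {u : Whit r l} {j d : ℤ} (hu : u ∈ filt r l j) (hd : j + (pos q - pos p) ≤ d) :
    euler ε a c c' (gen τ p q • u) - gen τ p q • euler ε a c c' u -
      (if ε = τ ∧ a = p ∧ c = q then gen τ p q • u else 0) ∈ filt r l d := by
  have hv := gen_smul_sub_mem ε (a := c') (b := a) (by omega) hu le_rfl
  have hB := bracket_smul_sub_mem (ε := ε) (τ := τ) hcc hc hle hu le_rfl
  have hB' := gen_smul_mem ε a c hB (d := d) (by omega)
  set v := gen ε c' a • u - χ r l (basisElt ε c' a) • u with hvdef
  set B := (if a = p then gen (ε + τ) c' q • u else 0) -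
        sgn ε τ • (if q = c' then gen (ε + τ) p a • u else 0) with hBdef
  have h1 : gen ε c' a • gen τ p q • u - χ r l (basisElt ε c' a) • gen τ p q • u =
      sgn ε τ • gen τ p q • v + B := by
    rw [gen_smul_gen_smul, hvdef, sgn_smul_smul_sub, hBdef, add_sub_right_comm]
  have h2 : (if ε = τ ∧ a = p ∧ c = q then gen τ p q • u else 0) =
      gen ε a c • (if ε = τ ∧ a = p ∧ c = q then u else 0) := by
    split_ifs with h
    · rw [h.1, h.2.1, h.2.2]
    · rw [smul_zero]
  rw [euler_apply, euler_apply, h1, ← hvdef, h2, smul_add, smul_comm (gen ε a c) (sgn ε τ),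
    gen_smul_gen_smul, smul_add, smul_smul, sgn_mul_self, one_smul, add_sub_right_comm,
    add_sub_cancel_left, add_sub_assoc, ← smul_sub (gen ε a c)]
  refine add_mem (Submodule.smul_mem _ _ (sub_mem ?_ (Submodule.smul_mem _ _ ?_))) hB'
  · split_ifs with h
    · subst h; exact gen_smul_mem _ _ _ hv (by omega)
    · exact zero_mem _
  · split_ifs with h
    · subst h; exact gen_smul_mem _ _ _ hv (by omega)
    · exact zero_mem _

open Classical in
/-- The number of occurrences of a letter in a word. -/
def occ (x : Letter r l) (w : List (Letter r l)) : ℕ := (w.map fun y => if x = y then 1 else 0).sum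

open Classical in
theorem occ_cons (x y : Letter r l) (w : List (Letter r l)) :
    occ x (y :: w) = (if x = y then 1 else 0) + occ x w := by simp [occ]

theorem one_le_deg_of_mem_coordLetters {x : Letter r l} (h : x ∈ coordLetters (trim r l)) :
    1 ≤ x.deg := by
  rcases h with ⟨ε, m, a, b, ha, hb, hm, hm'⟩ | ⟨t, ht, rfl⟩
  · simp only [Letter.deg]; omega
  · have := mem_trim.1 ht
    simp only [Letter.deg]; omega

theorem occ_le_wordDeg (x : Letter r l) {w : List (Letter r l)}
    (h : ∀ y ∈ w, y ∈ coordLetters (trim r l)) : (occ x w : ℤ) ≤ wordDeg w := by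
  induction w with
  | nil => simp [occ]
  | cons y w ih =>
    have h1 := one_le_deg_of_mem_coordLetters (h y (List.mem_cons_self ..))
    have h2 := ih fun z hz => h z (List.mem_cons_of_mem _ hz)
    rw [occ_cons, wordDeg_cons]
    split_ifs <;> push_cast <;> omega

theorem elt_smul_mem_filt (x : Letter r l) {u : Whit r l} {j d : ℤ} (hu : u ∈ filt r l j)
    (hd : j + x.deg ≤ d) : x.elt • u ∈ filt r l d := by
  cases x with
  | lin ε a b => exact gen_smul_mem _ _ _ hu hd
  | ser ε m a b => exact ser_smul_mem _ _ _ _ hu hd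

theorem wordVec_mem_filt (w : List (Letter r l)) {d : ℤ} (hd : wordDeg w ≤ d) :
    wordVec w ∈ filt r l d := by
  induction w generalizing d with
  | nil => rw [wordVec_nil]; exact π_one_mem_filt (by simpa using hd)
  | cons x w ih =>
    rw [wordVec_cons]
    exact elt_smul_mem_filt x (ih le_rfl) (by rw [wordDeg_cons] at hd; omega)

/-- The order of elimination: by degree (here shifted by `1`), then by starting position. -/
def rank (t : Fin 2 × Fin (r * l) × Fin (r * l)) : ℤ ×ₗ ℕ :=
  toLex ((pos t.2.2 : ℤ) - pos t.2.1, pos t.2.1)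

open Classical in
/-- Modulo lower degree, the Euler operator of a letter of maximal rank counts its occurrences. -/
theorem euler_wordVec_sub_mem {T : Finset (Fin 2 × Fin (r * l) × Fin (r * l))}
    {ε : Fin 2} {a c c' : Fin (r * l)} (hac : pos a ≤ pos c) (hcc : blk c' = blk c)
    (hc : pos c' = pos c + 1) (hmax : ∀ t ∈ T, rank t ≤ rank (ε, a, c))
    {w : List (Letter r l)} (hw : ∀ y ∈ w, y ∈ coordLetters T) :
    euler ε a c c' (wordVec w) - (occ (.lin ε a c) w : ℂ) • wordVec w ∈
      filt r l (wordDeg w - 1) := by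
  induction w with
  | nil =>
    rw [wordVec_nil, euler_of_mem_whittakerVectors hac hc π_one_mem_whittakerVectors]
    simp [occ]
  | cons x w ih =>
    have h1 := elt_smul_mem_filt x (ih fun z hz => hw z (List.mem_cons_of_mem _ hz))
      (d := wordDeg (x :: w) - 1) (by rw [wordDeg_cons]; omega)
    have hwm := wordVec_mem_filt w le_rfl
    have h2 : euler ε a c c' (x.elt • wordVec w) - x.elt • euler ε a c c' (wordVec w) -
        (if Letter.lin ε a c = x then x.elt • wordVec w else 0) ∈
          filt r l (wordDeg (x :: w) - 1) := by
      rcases hw x (List.mem_cons_self ..) with ⟨τ, m, p, q, hp, hq, hm, hm'⟩ | ⟨⟨τ, p, q⟩, ht, rfl⟩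
      · rw [if_neg (by simp), sub_zero]
        exact euler_ser_smul_sub_mem hac hc hp hq hwm
          (by rw [wordDeg_cons, Letter.deg]; omega)
      · have h3 := Prod.Lex.le_iff.1 (hmax _ ht)
        simp only [rank, ofLex_toLex] at h3
        have h4 := euler_gen_smul_sub_mem (ε := ε) (τ := τ) (p := p) (q := q)
          (d := wordDeg (Letter.lin τ p q :: w) - 1) hac hcc hc (by omega) hwm
          (by rw [wordDeg_cons, Letter.deg]; omega)
        simpa [Letter.elt] using h4
    have h3 := add_mem h2 h1
    rw [smul_sub, smul_comm x.elt (occ (.lin ε a c) w : ℂ)] at h3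
    rw [wordVec_cons, occ_cons]
    convert h3 using 1
    split_ifs with h
    · push_cast; rw [add_smul, one_smul]; abel
    · rw [zero_add]; abel

/-- The span of the words of degree at most `d` in the letters `coordLetters T` with at most `S`
occurrences of the letter `x`. -/
def occSpan (T : Finset (Fin 2 × Fin (r * l) × Fin (r * l))) (x : Letter r l) (S : ℕ) (d : ℤ) :
    Submodule ℂ (Whit r l) :=
  Submodule.span ℂ {v | ∃ w : List (Letter r l), (∀ y ∈ w, y ∈ coordLetters T) ∧
    wordDeg w ≤ d ∧ occ x w ≤ S ∧ wordVec w = v}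

/-- A letter of maximal rank can be removed from the leading term of a vector annihilated by its
Euler operator. -/
theorem mem_sup_of_occ_le {T : Finset (Fin 2 × Fin (r * l) × Fin (r * l))} {ε : Fin 2}
    {a c c' : Fin (r * l)} (hac : pos a ≤ pos c) (hcc : blk c' = blk c) (hc : pos c' = pos c + 1)
    (hmax : ∀ t ∈ T, rank t ≤ rank (ε, a, c)) {d : ℤ} (S : ℕ) {u : Whit r l}
    (hu : u ∈ occSpan T (.lin ε a c) S d ⊔ filt r l (d - 1))
    (hW : euler ε a c c' u = 0) :
    u ∈ wordSpan (coordLetters (T.erase (ε, a, c))) d ⊔ filt r l (d - 1) := by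
  induction S generalizing u with
  | zero =>
    have hle : occSpan T (.lin ε a c) 0 d ≤ wordSpan (coordLetters (T.erase (ε, a, c))) d := by
      refine Submodule.span_mono ?_
      rintro _ ⟨w, hw, hd, ho, rfl⟩
      refine ⟨w, fun x hx => ?_, hd, rfl⟩
      have hne : Letter.lin ε a c ≠ x := by
        intro h
        rw [Nat.le_zero, occ, List.sum_eq_zero_iff] at ho
        have := ho _ (List.mem_map_of_mem hx)
        simp [h] at this
      rcases hw x hx with h | ⟨t, ht, rfl⟩
      · exact Or.inl h
      · exact Or.inr ⟨t, Finset.mem_erase.2 ⟨fun h => hne (by rw [h]), ht⟩, rfl⟩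
    exact sup_le_sup_right hle _ hu
  | succ S ih =>
    refine ih ?_ hW
    -- Modulo lower degree, `S + 1 - euler` annihilates the words with `S + 1` occurrences, while on
    -- `u` it is multiplication by `S + 1`.
    set V := occSpan T (.lin ε a c) S d ⊔ filt r l (d - 1) with hV
    let φ : Whit r l →ₗ[ℂ] Whit r l := ((S + 1 : ℕ) : ℂ) • LinearMap.id - euler ε a c c'
    have h1 : occSpan T (.lin ε a c) (S + 1) d ⊔ filt r l (d - 1) ≤ V.comap φ := by
      refine sup_le (Submodule.span_le.2 ?_) ?_
      · rintro _ ⟨w, hw, hd, ho, rfl⟩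
        have h2 : _ ∈ V := (le_sup_right : filt r l (d - 1) ≤ V) (filt_mono (by omega)
          (euler_wordVec_sub_mem hac hcc hc hmax hw))
        have h3 : (((S + 1 : ℕ) : ℂ) - (occ (.lin ε a c) w : ℂ)) • wordVec w ∈ V := by
          rcases Nat.lt_or_eq_of_le ho with ho | ho
          · exact Submodule.smul_mem _ _ (Submodule.mem_sup_left
              (Submodule.subset_span ⟨w, hw, hd, by omega, rfl⟩))
          · rw [ho, sub_self, zero_smul]; exact zero_mem _
        have h4 := sub_mem h3 h2
        rw [sub_smul, sub_sub_sub_cancel_right] at h4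
        exact h4
      · intro v hv
        exact Submodule.mem_sup_right (sub_mem (Submodule.smul_mem _ _ hv) (euler_mem hac hc hv))
    have h2 : ((S + 1 : ℕ) : ℂ) • u - euler ε a c c' u ∈ V := h1 hu
    rw [hW, sub_zero] at h2
    exact (Submodule.smul_mem_iff _ (Nat.cast_ne_zero.2 S.succ_ne_zero)).1 h2

/-- The symbol of a Whittaker vector is a polynomial in the symbols of the generators of `W_χ`. -/
theorem mem_sup_of_mem_whittakerVectors {u : Whit r l} (hW : u ∈ whittakerVectors r l) {d : ℤ}
    (hu : u ∈ filt r l d) : u ∈ wordSpan (coordLetters ∅) d ⊔ filt r l (d - 1) := by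
  have key : ∀ (N : ℕ) (T : Finset (Fin 2 × Fin (r * l) × Fin (r * l))), T ⊆ trim r l →
      T.card = N → u ∈ wordSpan (coordLetters T) d ⊔ filt r l (d - 1) →
      u ∈ wordSpan (coordLetters ∅) d ⊔ filt r l (d - 1) := by
    intro N
    induction N with
    | zero =>
      intro T _ hN hT
      rwa [Finset.card_eq_zero.1 hN] at hT
    | succ N ih =>
      intro T hTt hN hT
      obtain ⟨⟨ε, a, c⟩, ht, hmax⟩ :=
        Finset.exists_max_image T rank (Finset.card_pos.1 (by omega))
      obtain ⟨hac, hcl⟩ := mem_trim.1 (hTt ht)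
      refine ih (T.erase (ε, a, c)) ((Finset.erase_subset _ _).trans hTt)
        (by rw [Finset.card_erase_of_mem ht, hN]; rfl) ?_
      refine mem_sup_of_occ_le (c' := idx (blk c) ⟨pos c + 1, hcl⟩) hac (by simp) (by simp) hmax
        d.toNat ?_ (euler_of_mem_whittakerVectors hac (by simp) hW)
      have hle : wordSpan (coordLetters T) d ≤ occSpan T (.lin ε a c) d.toNat d := by
        refine Submodule.span_mono ?_
        rintro _ ⟨w, hw, hd, rfl⟩
        have := occ_le_wordDeg (.lin ε a c) fun y hy => coordLetters_mono hTt (hw y hy)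
        exact ⟨w, hw, hd, by omega, rfl⟩
      exact sup_le_sup_right hle _ hT
  exact key _ _ subset_rfl rfl (Submodule.mem_sup_left (filt_le_wordSpan_trim d hu))

theorem wordSpan_coordLetters_le (d : ℤ) :
    wordSpan (coordLetters ∅) d ≤ whittakerVectors r l := by
  refine Submodule.span_le.2 ?_
  rintro _ ⟨w, hw, -, rfl⟩
  induction w with
  | nil => rw [wordVec_nil]; exact π_one_mem_whittakerVectors
  | cons x w ih =>
    rw [wordVec_cons]
    rcases hw x (List.mem_cons_self ..) with ⟨ε, m, a, b, ha, hb, -, -⟩ | ⟨t, ht, -⟩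
    · exact ser_smul_mem_whittakerVectors ha hb (ih fun y hy => hw y (List.mem_cons_of_mem _ hy))
    · simp at ht

theorem mem_wordSpan_of_mem_whittakerVectors (d : ℕ) {u : Whit r l}
    (hW : u ∈ whittakerVectors r l) (hu : u ∈ filt r l ((d : ℤ) - 1)) :
    ∃ d', u ∈ wordSpan (coordLetters ∅) d' := by
  refine ⟨d, ?_⟩
  induction d generalizing u with
  | zero =>
    rw [filt_eq_bot (by simp), Submodule.mem_bot] at hu
    rw [hu]; exact zero_mem _
  | succ d ih =>
    obtain ⟨v, hv, u', hu', rfl⟩ := Submodule.mem_sup.1 (mem_sup_of_mem_whittakerVectors hW hu)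
    have hvW := wordSpan_coordLetters_le _ hv
    refine add_mem (wordSpan_mono subset_rfl (by push_cast; omega) hv)
      (wordSpan_mono subset_rfl (by push_cast; omega) (ih ?_ ?_))
    · exact (Submodule.add_mem_iff_right _ hvW).1 hW
    · exact filt_mono (by push_cast; omega) hu'

theorem exists_mem_filt (u : Whit r l) : ∃ d : ℕ, u ∈ filt r l ((d : ℤ) - 1) := by
  obtain ⟨y, rfl⟩ := Submodule.mkQ_surjective _ u
  obtain ⟨y, rfl⟩ := RingQuot.mkAlgHom_surjective ℂ (EnvRel (r * l)) y
  let V : Submodule ℂ (Whit r l) := ⨆ d : ℕ, filt r l ((d : ℤ) - 1)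
  have hdir : Directed (· ≤ ·) fun d : ℕ => filt r l ((d : ℤ) - 1) :=
    (monotone_nat_of_le_succ fun d => filt_mono (by push_cast; omega)).directed_le
  have hmem : ∀ v, v ∈ V ↔ ∃ d : ℕ, v ∈ filt r l ((d : ℤ) - 1) := fun v =>
    Submodule.mem_iSup_of_directed _ hdir
  rw [← hmem]
  have hgen : ∀ ε (a b : Fin (r * l)), V ≤ V.comap (act (gen ε a b)) := by
    intro ε a b v hv
    obtain ⟨d, hd⟩ := (hmem v).1 hv
    exact (hmem _).2 ⟨((d : ℤ) + (pos b - pos a + 1)).toNat, gen_smul_mem _ _ _ hd (by omega)⟩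
  have hι : ∀ x : Q (r * l), ∀ v ∈ V, ι (r * l) x • v ∈ V := by
    intro x v hv
    have hx : x ∈ Submodule.span ℂ {x : Q (r * l) | ∃ ε i j, x = basisElt ε i j} := by
      rw [span_basisElt]; trivial
    induction hx using Submodule.span_induction with
    | mem x hx => obtain ⟨ε, i, j, rfl⟩ := hx; exact hgen ε i j hv
    | zero => rw [map_zero, zero_smul]; exact zero_mem _
    | add x y _ _ hx hy => rw [map_add, add_smul]; exact add_mem hx hy
    | smul c x _ hx => rw [map_smul, smul_assoc]; exact Submodule.smul_mem _ _ hx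
  have h1 : ∀ v ∈ V, tensorToU (r * l) y • v ∈ V := by
    induction y using TensorAlgebra.induction with
    | algebraMap c =>
      intro v hv
      rw [AlgHom.commutes, algebraMap_smul]
      exact Submodule.smul_mem _ _ hv
    | ι x => exact hι x
    | mul x y hx hy => intro v hv; rw [map_mul, mul_smul]; exact hx _ (hy v hv)
    | add x y hx hy => intro v hv; rw [map_add, add_smul]; exact add_mem (hx v hv) (hy v hv)
  have h2 := h1 (π r l 1) ((hmem _).2 ⟨1, π_one_mem_filt (by simp)⟩)
  rwa [← map_smul, smul_eq_mul, mul_one] at h2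

end Euler

/-! ### Generation -/

section Generation

variable {r l : ℕ}

/-- The generators of `W_χ`, as endomorphisms of the Whittaker module. -/
def wGens (r l : ℕ) (hl : 0 < l) : Set (W r l) :=
  {w | ∃ (p q : Fin r), ∃ k ∈ Finset.Icc 1 l,
      (frobenius r l w : Whit r l) = π r l (eS (l + k - 1)
          (idx p (⟨l - 1, Nat.sub_one_lt_of_lt hl⟩ : Fin l)) (idx q (⟨0, hl⟩ : Fin l))) ∨
      (frobenius r l w : Whit r l) = π r l (fS (l + k - 1)
          (idx p (⟨l - 1, Nat.sub_one_lt_of_lt hl⟩ : Fin l)) (idx q (⟨0, hl⟩ : Fin l)))}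

theorem π_eq_smul (y : U (r * l)) : π r l y = y • π r l 1 := by
  rw [← map_smul, smul_eq_mul, mul_one]

theorem π_ser_mem_whittakerVectors (ε : Fin 2) (m : ℕ) {a b : Fin (r * l)}
    (ha : pos a + 1 = l) (hb : pos b = 0) : π r l (ser ε m a b) ∈ whittakerVectors r l := by
  rw [π_eq_smul]
  exact ser_smul_mem_whittakerVectors ha hb π_one_mem_whittakerVectors

theorem mem_wGens {hl : 0 < l} {ε : Fin 2} {m : ℕ} {a b : Fin (r * l)} (ha : pos a + 1 = l)
    (hb : pos b = 0) (hm : l ≤ m) (hm' : m < 2 * l) {w : W r l}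
    (hw : (frobenius r l w : Whit r l) = π r l (ser ε m a b)) : w ∈ wGens r l hl := by
  have ha' : idx (blk a) ⟨l - 1, Nat.sub_one_lt_of_lt hl⟩ = a :=
    index_ext_iff.2 ⟨by simp, by simp; omega⟩
  have hb' : idx (blk b) ⟨0, hl⟩ = b := index_ext_iff.2 ⟨by simp, by simp [hb]⟩
  refine ⟨blk a, blk b, m + 1 - l, Finset.mem_Icc.2 (by omega), ?_⟩
  rw [show l + (m + 1 - l) - 1 = m by omega, ha', hb']
  fin_cases ε
  exacts [Or.inl hw, Or.inr hw]

/-- A word in the generators, applied to `π(1)`, is the image of their product in `W_χ`. -/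
theorem exists_mem_adjoin_of_mem_wordSpan (hl : 0 < l) (d : ℤ) {u : Whit r l}
    (hu : u ∈ wordSpan (coordLetters ∅) d) :
    ∃ w ∈ Algebra.adjoin ℂ (wGens r l hl), (frobenius r l w : Whit r l) = u := by
  let V : Submodule ℂ (Whit r l) := (Algebra.adjoin ℂ (wGens r l hl)).toSubmodule.map
    ((whittakerVectors r l).subtype ∘ₗ (frobenius r l).toLinearMap)
  suffices h : wordSpan (coordLetters ∅) d ≤ V from h hu
  refine Submodule.span_le.2 ?_
  rintro _ ⟨w, hw, -, rfl⟩
  induction w with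
  | nil => exact ⟨1, one_mem (Algebra.adjoin ℂ (wGens r l hl)), by rw [wordVec_nil]; rfl⟩
  | cons x w ih =>
    obtain ⟨v, hv, hvw⟩ := ih fun y hy => hw y (List.mem_cons_of_mem _ hy)
    rcases hw x (List.mem_cons_self ..) with ⟨ε, m, a, b, ha, hb, hm, hm'⟩ | ⟨t, ht, -⟩
    · have h1 : (frobenius r l ((frobenius r l).symm ⟨_, π_ser_mem_whittakerVectors ε m ha hb⟩) :
          Whit r l) = π r l (ser ε m a b) := by
        rw [LinearEquiv.apply_symm_apply]
      have h2 : (frobenius r l v : Whit r l) = π r l (w.map Letter.elt).prod := by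
        rw [π_eq_smul]
        exact hvw
      have hv' : v ∈ Algebra.adjoin ℂ (wGens r l hl) := hv
      refine ⟨_, Subalgebra.mul_mem _ (Algebra.subset_adjoin (mem_wGens ha hb hm hm' h1)) hv', ?_⟩
      refine (frobenius_mul _ _ _ _ h1 h2).trans ?_
      rw [π_eq_smul, mul_smul]
      exact (wordVec_cons (Letter.ser ε m a b) w).symm
    · simp at ht

theorem adjoin_wGens (hl : 0 < l) : Algebra.adjoin ℂ (wGens r l hl) = ⊤ := by
  refine eq_top_iff.2 fun w _ => ?_
  obtain ⟨d, hd⟩ := exists_mem_filt (frobenius r l w : Whit r l)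
  obtain ⟨d', hd'⟩ := mem_wordSpan_of_mem_whittakerVectors d (frobenius r l w).2 hd
  obtain ⟨w', hw', h⟩ := exists_mem_adjoin_of_mem_wordSpan hl d' hd'
  rwa [← (frobenius r l).injective (Subtype.ext h)]

end Generation

end

end QueerW

theorem mainTheorem3 (r l : ℕ) (hl : 0 < l) :
    (∀ (p q : Fin r), ∀ k ∈ Finset.Icc 1 l,
      QueerW.π r l (QueerW.eS (l + k - 1)
          (QueerW.idx p (⟨l - 1, Nat.sub_one_lt_of_lt hl⟩ : Fin l))
          (QueerW.idx q (⟨0, hl⟩ : Fin l))) ∈ QueerW.whittakerVectors r l ∧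
      QueerW.π r l (QueerW.fS (l + k - 1)
          (QueerW.idx p (⟨l - 1, Nat.sub_one_lt_of_lt hl⟩ : Fin l))
          (QueerW.idx q (⟨0, hl⟩ : Fin l))) ∈ QueerW.whittakerVectors r l) ∧
    Algebra.adjoin ℂ {w : QueerW.W r l | ∃ (p q : Fin r), ∃ k ∈ Finset.Icc 1 l,
      (QueerW.frobenius r l w : QueerW.Whit r l) = QueerW.π r l (QueerW.eS (l + k - 1)
          (QueerW.idx p (⟨l - 1, Nat.sub_one_lt_of_lt hl⟩ : Fin l))
          (QueerW.idx q (⟨0, hl⟩ : Fin l))) ∨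
      (QueerW.frobenius r l w : QueerW.Whit r l) = QueerW.π r l (QueerW.fS (l + k - 1)
          (QueerW.idx p (⟨l - 1, Nat.sub_one_lt_of_lt hl⟩ : Fin l))
          (QueerW.idx q (⟨0, hl⟩ : Fin l)))} = ⊤ := by
  refine ⟨fun p q k _ => ⟨?_, ?_⟩, QueerW.adjoin_wGens hl⟩
  · exact QueerW.π_ser_mem_whittakerVectors 0 _ (by simp; omega) (by simp)
  · exact QueerW.π_ser_mem_whittakerVectors 1 _ (by simp; omega) (by simp)
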